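/- Let $\mathfrak H$ be a real separable Hilbert space, $X=\{X(h):h\in\mathfrak H\}$ an isonormal Gaussian process over $\mathfrak H$ on a probability space, $D$ the Malliavin derivative and $L^{-1}F=-\sum_{p\ge1}\frac1p J_pF$ the pseudo-inverse of the Ornstein–Uhlenbeck generator, $J_p$ being the orthogonal projection of $L^2(\Omega)$ onto the $p$-th Wiener chaos. Let $\nu>0$, and let $F=I_2(f)$ be an element of the second Wiener chaos with $\mathbb E[F^2]=2\nu$. Define $\Gamma_0=F$, $\Gamma_{i+1}=\langle D\Gamma_i,-DL^{-1}F\rangle_{\mathfrak H}$ and $\overline\Gamma_j=\Gamma_j-\mathbb E[\Gamma_j]$. Write $$V=\operatorname{Var}(\Gamma_2-2\Gamma_1),\qquad M=\mathbb E\big[(\overline\Gamma_3-2\overline\Gamma_2)(\overline\Gamma_2-2\overline\Gamma_1)\big],$$ and assume $M=\operatorname{Cov}(\Gamma_3-2\Gamma_2,\Gamma_2-2\Gamma_1)\ge0$. For $\beta\in\mathbb R$ let $$\Phi_F(\beta)=\operatorname{Var}\big((\Gamma_3-2\Gamma_2)-2\beta^2(\Gamma_2-2\Gamma_1)\big),$$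 and put $\beta^{\pm}_{\min}=\pm\sqrt{M/(2V)}$ and $\beta_0=\sqrt{M/V}\ge0$, with the convention that these numbers are $0$ if $V=0$. Let $G(\nu)$ have the law of $2\widehat G-\nu$, where $\widehat G$ has the Gamma law with shape $\nu/2$ and rate $1$. Let $\kappa_n(F)=i^{-n}\frac{d^n}{dt^n}\log\mathbb E[e^{itF}]\big|_{t=0}$ be the $n$-th cumulant of $F$. Then: 1. If $M>0$ or $V=0$, then $\Phi_F$ has a local maximum at $\beta=0$. $\Phi_F$ attains its global minimum at $\beta^+_{\min}$ and $\beta^-_{\min}$ and, if $V\neq0$, nowhere else. 2. $F\overset{\mathcal D}{=}G(\nu)$ if and only if $\Phi_F(\beta)=0$ for some $\beta\notin\{\beta^+_{\min},\beta^-_{\min}\}$. In particular, $\Phi_F(1)=0$ implies $F\overset{\mathcal D}{=}G(\nu)$. 3. $$0\le\Phi_F(1)=\frac{\kappa_8(F)}{7!}-8\frac{\kappa_7(F)}{6!}+24\frac{\kappa_6(F)}{5!}-32\frac{\kappa_5(F)}{4!}+16\frac{\kappa_4(F)}{3!}\le2\operatorname{Var}^2(\Gamma_1-2F).$$ 4.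 If $\beta_0\le1$, then $\operatorname{Var}(\Gamma_3-2\Gamma_2)\le2\operatorname{Var}^2(\Gamma_1-2F)$. 5. If $\beta_0\ge1$, then $$\Phi_F(\beta^-_{\min})=\Phi_F(\beta^+_{\min})=\operatorname{Var}(\Gamma_3-2\Gamma_2)-\frac{M^2}{V}\le\operatorname{Var}\big((\Gamma_3-2\Gamma_2)-2(\Gamma_2-2\Gamma_1)\big)\le\operatorname{Var}(\Gamma_3-2\Gamma_2).$$ 6. If $\Phi_F(\beta^{\pm}_{\min})=0$, then, with $k=\beta_0^2$, there are $\ell_1,\ell_2\in\mathbb N_0$ with $\ell_1\frac{k^2}{4}+\ell_2=\nu$ such that $$F\overset{\mathcal D}{=}\sum_{i=1}^{\ell_1}\frac k2(N_i^2-1)+\sum_{j=1}^{\ell_2}(N_j'^2-1),$$ where all $N_i,N_j'$ are i.i.d. $\mathscr N(0,1)$ and empty sums are $0$. Equivalently, the law of $F$ is the convolution of the laws $2\,\Gamma(\frac{\ell_1}{2},\frac2k)-\frac{\ell_1k}{2}$ and $2\,\Gamma(\frac{\ell_2}{2},1)-\ell_2$, where $\Gamma(r,\lambda)$ is the Gamma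 law with shape $r$ and rate $\lambda$, and a factor with $\ell_1=0$ or $\ell_2=0$ is read as the point mass at $0$. -/

import Mathlib

open MeasureTheory ProbabilityTheory Set Filter Topology
open scoped ENNReal

section SecondChaosDefs

variable {Ω : Type*} {mΩ : MeasurableSpace Ω}
variable {H : Type*} [NormedAddCommGroup H] [InnerProductSpace ℝ H]

/-- `X` is an isonormal Gaussian process over the real Hilbert space `H`: a centered, jointly
Gaussian family with `E[X(g) X(h)] = ⟨g, h⟩`. -/
structure IsIsonormal (X : H → Ω → ℝ) (P : Measure Ω) : Prop where
  gaussian : IsGaussianProcess X P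
  centered : ∀ h : H, ∫ ω, X h ω ∂P = 0
  covariance_eq : ∀ g h : H, ∫ ω, X g ω * X h ω ∂P = inner ℝ g h

/-- The `q`-th Wiener chaos of `X`: the closed linear span in `L²(Ω)` of the variables
`H_q(X(h))`, `‖h‖ = 1`, with `H_q` the (probabilists') Hermite polynomial. -/
noncomputable abbrev wienerChaos (X : H → Ω → ℝ) (P : Measure Ω) (q : ℕ) :
    Submodule ℝ (Lp ℝ 2 P) :=
  (Submodule.span ℝ {Y : Lp ℝ 2 P | ∃ h : H, ‖h‖ = 1 ∧
    ∀ᵐ ω ∂P, Y ω = Polynomial.aeval (X h ω) (Polynomial.hermite q)}).topologicalClosure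

/-- The pseudo-inverse `L⁻¹ F = - ∑_{p ≥ 1} (1/p) J_p F` of the Ornstein-Uhlenbeck generator,
where `J_p F` is the orthogonal projection of `F` onto the `p`-th chaos, that is the `p`-th term
`I_p(f_p)` of the chaotic expansion of `F`. -/
noncomputable def pseudoInverseL (X : H → Ω → ℝ) (P : Measure Ω) (F : Lp ℝ 2 P) : Lp ℝ 2 P :=
  -∑' p : ℕ, ((p : ℝ) + 1)⁻¹ • (wienerChaos X P (p + 1)).starProjection F

/-- The smooth random variable `g(X(φ₁), …, X(φₙ))`. -/
def smoothVar (X : H → Ω → ℝ) {n : ℕ} (g : (Fin n → ℝ) → ℝ) (φ : Fin n → H) : Ω → ℝ :=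
  fun ω => g (fun i => X (φ i) ω)

/-- The derivative `∑ᵢ ∂ᵢg(X(φ₁), …, X(φₙ)) φᵢ` of a smooth random variable. -/
noncomputable def smoothVarDeriv (X : H → Ω → ℝ) {n : ℕ} (g : (Fin n → ℝ) → ℝ)
    (φ : Fin n → H) : Ω → H :=
  fun ω => ∑ i, fderiv ℝ g (fun j => X (φ j) ω) (Pi.single i 1) • φ i

/-- `u` is a Malliavin derivative of `F`: the pair `(F, u)` lies in the closure, in
`L²(Ω) × L²(Ω; H)`, of the graph of the derivative on smooth random variables (those for which `g`
is `C^∞` with all partial derivatives of at most polynomial growth). -/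
def IsMalliavinDeriv (X : H → Ω → ℝ) (P : Measure Ω) (F : Ω → ℝ) (u : Ω → H) : Prop :=
  MemLp F 2 P ∧ MemLp u 2 P ∧ ∀ ε : ℝ≥0∞, 0 < ε →
    ∃ (n : ℕ) (g : (Fin n → ℝ) → ℝ) (φ : Fin n → H), Function.HasTemperateGrowth g ∧
      eLpNorm (F - smoothVar X g φ) 2 P < ε ∧ eLpNorm (u - smoothVarDeriv X g φ) 2 P < ε

open Classical in
/-- The Malliavin derivative `D F` (set to `0` outside the domain `𝔻^{1,2}`). -/
noncomputable def malliavinDeriv (X : H → Ω → ℝ) (P : Measure Ω) (F : Ω → ℝ) : Ω → H :=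
  if h : ∃ u : Ω → H, IsMalliavinDeriv X P F u then h.choose else 0

/-- The iterated Gamma operators: `Γ₀(F) = F`, `Γ_{i+1}(F) = ⟨D Γ_i(F), -D L⁻¹ F⟩`. -/
noncomputable def gammaOp (X : H → Ω → ℝ) (P : Measure Ω) (F : Lp ℝ 2 P) : ℕ → Ω → ℝ
  | 0 => fun ω => F ω
  | i + 1 => fun ω => inner ℝ (malliavinDeriv X P (gammaOp X P F i) ω)
      (-malliavinDeriv X P (pseudoInverseL X P F) ω)

/-- The difference `Γ_{r+1}(F) - 2 Γ_r(F)`. -/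
noncomputable def gammaDiff (X : H → Ω → ℝ) (P : Measure Ω) (F : Lp ℝ 2 P) (r : ℕ) : Ω → ℝ :=
  fun ω => gammaOp X P F (r + 1) ω - 2 * gammaOp X P F r ω

/-- The centered Gamma operators `Γ_j(F) - E[Γ_j(F)]`. -/
noncomputable def centeredGammaOp (X : H → Ω → ℝ) (P : Measure Ω) (F : Lp ℝ 2 P) (j : ℕ) :
    Ω → ℝ :=
  fun ω => gammaOp X P F j ω - ∫ ω', gammaOp X P F j ω' ∂P

/-- `Φ_F(β) = Var((Γ₃ - 2Γ₂) - 2β²(Γ₂ - 2Γ₁))`. -/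
noncomputable def biquadraticPhi (X : H → Ω → ℝ) (P : Measure Ω) (F : Lp ℝ 2 P) (β : ℝ) : ℝ :=
  variance (fun ω => gammaDiff X P F 2 ω - 2 * β ^ 2 * gammaDiff X P F 1 ω) P

/-- The mixed moment of the centered differences
`E[(Γ₃ - 2Γ₂ - E[…]) (Γ₂ - 2Γ₁ - E[…])]`. -/
noncomputable def mixedMoment (X : H → Ω → ℝ) (P : Measure Ω) (F : Lp ℝ 2 P) : ℝ :=
  ∫ ω, (centeredGammaOp X P F 3 ω - 2 * centeredGammaOp X P F 2 ω) *
    (centeredGammaOp X P F 2 ω - 2 * centeredGammaOp X P F 1 ω) ∂P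

/-- The nonnegative global minimizer `β⁺_min` of `Φ_F` (equal to `0` if `Var(Γ₂ - 2Γ₁) = 0`);
`β⁻_min` is its negative. -/
noncomputable def betaMin (X : H → Ω → ℝ) (P : Measure Ω) (F : Lp ℝ 2 P) : ℝ :=
  Real.sqrt (mixedMoment X P F / (2 * variance (gammaDiff X P F 1) P))

/-- The nonnegative root `β₀` (equal to `0` if `Var(Γ₂ - 2Γ₁) = 0`). -/
noncomputable def betaZero (X : H → Ω → ℝ) (P : Measure Ω) (F : Lp ℝ 2 P) : ℝ :=
  Real.sqrt (mixedMoment X P F / variance (gammaDiff X P F 1) P)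

end SecondChaosDefs

/-- The `n`-th cumulant `i⁻ⁿ (d/dt)ⁿ log φ_Y(t) |_{t = 0}` of a real random variable, `φ_Y` its
characteristic function; it is real whenever it exists. -/
noncomputable def cumulant {Ω : Type*} {mΩ : MeasurableSpace Ω} (P : Measure Ω) (Y : Ω → ℝ)
    (n : ℕ) : ℝ :=
  (iteratedDeriv n (fun t : ℝ => Complex.log (charFun (P.map Y) t)) 0 / Complex.I ^ n).re

/-- The law of `G(ν) = 2 Ĝ(ν/2) - ν`, where `Ĝ(ν/2)` is standard Gamma with shape `ν/2`. -/
noncomputable def centeredGammaLaw (ν : ℝ) : Measure ℝ :=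
  (gammaMeasure (ν / 2) 1).map (fun x => 2 * x - ν)

/-- The centered law `2 Γ(ℓ/2, 2/k) - ℓ k / 2`, where `Γ(shape, rate)` is the Gamma law;
the point mass at `0` if `ℓ = 0`. -/
noncomputable def scaledGammaLaw (ℓ : ℕ) (k : ℝ) : Measure ℝ :=
  if ℓ = 0 then Measure.dirac 0
  else (gammaMeasure ((ℓ : ℝ) / 2) (2 / k)).map (fun x => 2 * x - ℓ * k / 2)

/-- The law of `∑_{i ≤ ℓ₁} (k/2)(N_i² - 1) + ∑_{j ≤ ℓ₂} (N_j'² - 1)` with all `N_i`, `N_j'`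
i.i.d. standard normal. -/
noncomputable def mixedChiSqLaw (ℓ₁ ℓ₂ : ℕ) (k : ℝ) : Measure ℝ :=
  (Measure.pi (fun _ : Fin ℓ₁ ⊕ Fin ℓ₂ => gaussianReal 0 1)).map
    (fun x => (∑ i, k / 2 * (x (Sum.inl i) ^ 2 - 1)) + (∑ j, (x (Sum.inr j) ^ 2 - 1)))

/-! ### Functions of temperate growth evaluated at Gaussian vectors. -/

section TemperateGrowth

variable {E : Type*} [NormedAddCommGroup E] [NormedSpace ℝ E]
  {G : Type*} [NormedAddCommGroup G] [NormedSpace ℝ G]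

/-! The whole theorem reduces to sums over eigenvalues. To `F` one attaches the operator `A_F` with
`⟨A_F g, h⟩ = E[F X(g) X(h)] / 2`. It is symmetric and compact, and its eigenvectors `eᵢ` with
eigenvalues `λᵢ` give `F = ∑ λᵢ (X(eᵢ)² - 1)` with `∑ λᵢ² = ν` (`exists_hasSum_chaosVar`). On such
diagonal variables the Malliavin derivative is explicit and `L⁻¹` is `-1/2`, so up to a constant
`Γ_j = ∑ 2^j λᵢ^(j+1) (X(eᵢ)² - 1)` (`exists_gammaOp_ae_eq`). Since the derivative is defined by
choice from a closure, this needs closability, which follows from Gaussian integration by parts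
(`integral_smoothVar_mul`, `isMalliavinDeriv_unique`).

Because the `X(eᵢ)² - 1` are orthogonal with variance 2, `Φ_F(β) = 128 ∑ λᵢ⁴ (λᵢ - 1)² (λᵢ - β²)²`.
This is also the biquadratic `W - 4β²M + 4β⁴V` with `W = Var(Γ₃ - 2Γ₂)`, so completing the square
locates the minima. A zero of `Φ_F` forces every `λᵢ` into `{0, 1, β²}`. A zero away from `±β_min`
forces `V = 0`, hence every `λᵢ` into `{0, 1}`. The bound at `β = 1` is `∑ bᵢ² ≤ (∑ bᵢ)²` with `bᵢ =
λᵢ² (λᵢ - 1)²`.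

Laws are identified by characteristic functions: that of `F` is the product of those of the summands
(`charFun_map_eq_exp`). Expanding its logarithm at 0 gives `κ_n = 2^(n-1) (n-1)! ∑ λᵢ^n`
(`cumulant_eq`), whence the cumulant formula. Conversely, the cumulants of `G(ν)` make `Φ_F(1)`
vanish, which recovers the eigenvalues from the law. -/

theorem Function.HasTemperateGrowth.fderiv {g : E → G} (hg : g.HasTemperateGrowth) :
    (fderiv ℝ g).HasTemperateGrowth := by
  refine ⟨hg.1.fderiv_right (by simp), fun n => ?_⟩
  obtain ⟨k, C, h⟩ := hg.2 (n + 1)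
  exact ⟨k, C, fun x => by rw [norm_iteratedFDeriv_fderiv]; exact h x⟩

theorem Function.HasTemperateGrowth.fderiv_apply {g : E → G} (hg : g.HasTemperateGrowth) (v : E) :
    (fun x => _root_.fderiv ℝ g x v).HasTemperateGrowth :=
  (ContinuousLinearMap.apply ℝ G v).hasTemperateGrowth.comp hg.fderiv

/-- Gaussian vectors have moments of every order, which absorb polynomial growth. Powers of `1 +
‖Z‖` are handled by induction, each Hölder step doubling the exponent. -/
theorem Function.HasTemperateGrowth.memLp_comp [MeasurableSpace E] [BorelSpace E] [CompleteSpace E]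
    [SecondCountableTopology E] [SecondCountableTopology G] {Ω : Type*} {mΩ : MeasurableSpace Ω}
    {P : Measure Ω} {g : E → G} (hg : g.HasTemperateGrowth) {Z : Ω → E} (hZ : HasGaussianLaw Z P)
    {p : ℝ≥0∞} (hp : p ≠ ⊤) : MemLp (fun ω => g (Z ω)) p P := by
  have := hZ.isProbabilityMeasure
  obtain ⟨k, C, h⟩ := hg.2 0
  have hmeas : AEStronglyMeasurable (fun ω => g (Z ω)) P :=
    hg.1.continuous.comp_aestronglyMeasurable hZ.aemeasurable.aestronglyMeasurable
  have key : ∀ k : ℕ, ∀ p : ℝ≥0∞, p ≠ ⊤ → MemLp (fun ω => (1 + ‖Z ω‖) ^ k) p P := by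
    intro k
    induction k with
    | zero => intro p _; simpa using memLp_const (1 : ℝ)
    | succ k ih =>
      intro p hp
      have h2 : p * 2 ≠ ⊤ := ENNReal.mul_ne_top hp (by simp)
      have h1 : MemLp (fun ω => 1 + ‖Z ω‖) (p * 2) P :=
        (memLp_const (1 : ℝ)).add (hZ.memLp h2).norm
      have : ENNReal.HolderTriple (p * 2) (p * 2) p := ⟨by
        rw [ENNReal.mul_inv (by simp) (by simp), ← mul_add, ENNReal.inv_two_add_inv_two, mul_one]⟩
      simpa only [pow_succ] using h1.mul' (ih _ h2)
  refine ((key k p hp).const_mul C).mono hmeas (ae_of_all _ fun ω => ?_)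
  have := h (Z ω)
  rw [norm_iteratedFDeriv_zero] at this
  exact this.trans (le_abs_self _)

theorem Function.HasTemperateGrowth.integrable_comp [MeasurableSpace E] [BorelSpace E]
    [CompleteSpace E]
    [SecondCountableTopology E] [SecondCountableTopology G] {Ω : Type*} {mΩ : MeasurableSpace Ω}
    {P : Measure Ω} {g : E → G} (hg : g.HasTemperateGrowth) {Z : Ω → E} (hZ : HasGaussianLaw Z P) :
    Integrable (fun ω => g (Z ω)) P :=
  memLp_one_iff_integrable.1 (hg.memLp_comp hZ (by simp))

end TemperateGrowth

/-! ### Stein's identity in one dimension. -/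

section Stein

theorem hasDerivAt_gaussianPDFReal (v : NNReal) (x : ℝ) :
    HasDerivAt (gaussianPDFReal 0 v) (-(x / v) * gaussianPDFReal 0 v x) x := by
  unfold gaussianPDFReal
  have h : HasDerivAt (fun x : ℝ => -(x - 0) ^ 2 / (2 * (v : ℝ))) (-(x / v)) x := by
    have h1 : HasDerivAt (fun x : ℝ => -(x - 0) ^ 2 / (2 * (v : ℝ)))
        (-(2 * (x - 0) ^ 1 * 1) / (2 * (v : ℝ))) x :=
      ((((hasDerivAt_id' x).sub_const 0).fun_pow 2).fun_neg).div_const _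
    refine h1.congr_deriv ?_
    by_cases hv : (v : ℝ) = 0
    · simp [hv]
    · simp; field_simp
  refine (h.exp.const_mul (Real.sqrt (2 * Real.pi * v))⁻¹).congr_deriv ?_
  ring

/-- Stein's identity for a centered real Gaussian measure. -/
theorem integral_mul_id_gaussianReal (v : NNReal) {f f' : ℝ → ℝ}
    (hf : ∀ x, HasDerivAt f (f' x) x) (h0 : Integrable f (gaussianReal 0 v))
    (h1 : Integrable (fun x => f x * x) (gaussianReal 0 v))
    (h2 : Integrable f' (gaussianReal 0 v)) :
    ∫ x, f x * x ∂gaussianReal 0 v = v * ∫ x, f' x ∂gaussianReal 0 v := by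
  by_cases hv : v = 0
  · simp [hv]
  have hv' : (v : ℝ) ≠ 0 := by exact_mod_cast hv
  have conv : ∀ u : ℝ → ℝ, Integrable u (gaussianReal 0 v) →
      Integrable (fun x => gaussianPDFReal 0 v x * u x) := by
    intro u hu
    rw [gaussianReal_of_var_ne_zero _ hv, integrable_withDensity_iff_integrable_smul'
      (measurable_gaussianPDF _ _) (ae_of_all _ fun _ => gaussianPDF_lt_top)] at hu
    simpa using hu
  have i0 := conv _ h0
  have i1 := conv _ h1
  have i2 := conv _ h2
  have hd : ∀ x, HasDerivAt (fun x => gaussianPDFReal 0 v x * f x)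
      (gaussianPDFReal 0 v x * f' x - (gaussianPDFReal 0 v x * (f x * x)) / v) x := by
    intro x
    refine ((hasDerivAt_gaussianPDFReal v x).fun_mul (hf x)).congr_deriv ?_
    field_simp
    ring
  -- The product of density and `f` is integrable with integrable derivative, so that derivative has
  -- integral zero; this is the identity divided by `v`.
  have := integral_eq_zero_of_hasDerivAt_of_integrable hd (i2.sub (i1.div_const _)) i0
  rw [integral_sub i2 (i1.div_const _), integral_div] at this
  rw [integral_gaussianReal_eq_integral_smul hv, integral_gaussianReal_eq_integral_smul hv]
  simp only [smul_eq_mul]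
  rw [sub_eq_zero] at this
  rw [this]
  field_simp

end Stein

/-! ### Gaussian integration by parts for smooth random variables. -/

namespace IsIsonormal

variable {Ω : Type*} {mΩ : MeasurableSpace Ω} {P : Measure Ω}
  {H : Type*} [NormedAddCommGroup H] [InnerProductSpace ℝ H] {X : H → Ω → ℝ}

theorem hasGaussianLaw_pi (hX : IsIsonormal X P) {κ : Type*} [Fintype κ] (ψ : κ → H) :
    HasGaussianLaw (fun ω k => X (ψ k) ω) P :=
  ((hX.gaussian.comp_right ψ).hasGaussianLaw Finset.univ).map_fun
    (ContinuousLinearMap.pi fun k =>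
      ContinuousLinearMap.proj (R := ℝ) (φ := fun _ : (Finset.univ : Finset κ) => ℝ)
        ⟨k, Finset.mem_univ k⟩)

theorem memLp (hX : IsIsonormal X P) (h : H) {p : ℝ≥0∞} (hp : p ≠ ⊤) : MemLp (X h) p P :=
  (hX.gaussian.hasGaussianLaw_eval h).memLp hp

theorem covariance_apply (hX : IsIsonormal X P) (g h : H) : cov[X g, X h; P] = inner ℝ g h := by
  have := hX.gaussian.isProbabilityMeasure
  rw [covariance_eq_sub (hX.memLp g (by simp)) (hX.memLp h (by simp)), hX.centered, zero_mul,
    sub_zero]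
  exact hX.covariance_eq g h

theorem map_eq (hX : IsIsonormal X P) (h : H) :
    P.map (X h) = gaussianReal 0 (‖h‖₊ ^ 2) := by
  rw [(hX.gaussian.hasGaussianLaw_eval h).map_eq_gaussianReal, hX.centered]
  congr 1
  rw [← covariance_self (hX.gaussian.aemeasurable h), hX.covariance_apply,
    real_inner_self_eq_norm_sq]
  ext
  simp

theorem memLp_smoothVar (hX : IsIsonormal X P) {n : ℕ} {g : (Fin n → ℝ) → ℝ}
    (hg : g.HasTemperateGrowth) (φ : Fin n → H) {p : ℝ≥0∞} (hp : p ≠ ⊤) :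
    MemLp (smoothVar X g φ) p P :=
  hg.memLp_comp (hX.hasGaussianLaw_pi φ) hp

theorem memLp_smoothVarDeriv (hX : IsIsonormal X P) {n : ℕ} {g : (Fin n → ℝ) → ℝ}
    (hg : g.HasTemperateGrowth) (φ : Fin n → H) {p : ℝ≥0∞} (hp : p ≠ ⊤) :
    MemLp (smoothVarDeriv X g φ) p P := by
  refine memLp_finsetSum _ fun i _ => ?_
  have h1 := (hg.fderiv_apply (Pi.single i 1)).memLp_comp (hX.hasGaussianLaw_pi φ) hp
  exact ((ContinuousLinearMap.toSpanSingleton ℝ (φ i)).comp_memLp' h1)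

theorem inner_smoothVarDeriv {n : ℕ} (g : (Fin n → ℝ) → ℝ) (φ : Fin n → H) (h : H) (ω : Ω) :
    inner ℝ h (smoothVarDeriv X g φ ω) =
      fderiv ℝ g (fun j => X (φ j) ω) (fun i => inner ℝ h (φ i)) := by
  rw [smoothVarDeriv, inner_sum]
  conv_rhs => rw [← Finset.univ_sum_single (fun i => inner ℝ h (φ i)), map_sum]
  refine Finset.sum_congr rfl fun i _ => ?_
  rw [inner_smul_right]
  have : (Pi.single i (inner ℝ h (φ i)) : Fin n → ℝ) =
      (inner ℝ h (φ i) : ℝ) • Pi.single i (1 : ℝ) := by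
    rw [← Pi.single_smul, smul_eq_mul, mul_one]
  rw [this, map_smul, smul_eq_mul, mul_comm]

/-- Gaussian integration by parts on smooth random variables. -/
theorem integral_smoothVar_mul (hX : IsIsonormal X P) {n : ℕ} {g : (Fin n → ℝ) → ℝ}
    (hg : g.HasTemperateGrowth) (φ : Fin n → H) (h : H) :
    ∫ ω, smoothVar X g φ ω * X h ω ∂P = ∫ ω, inner ℝ h (smoothVarDeriv X g φ ω) ∂P := by
  have := hX.gaussian.isProbabilityMeasure
  simp_rw [inner_smoothVarDeriv]
  -- The regression below divides by `‖h‖²`, so `h = 0`, where `X 0` vanishes almost surely, is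
  -- separate.
  by_cases hh : h = 0
  · subst hh
    have h0 : X 0 =ᵐ[P] 0 := by
      have := hX.covariance_eq 0 0
      rw [inner_zero_left, integral_eq_zero_iff_of_nonneg (fun ω => mul_self_nonneg _)
        ((hX.memLp 0 (p := 2) (by simp)).integrable_mul (hX.memLp 0 (p := 2) (by simp)))] at this
      filter_upwards [this] with ω hω
      simpa using hω
    have : ∀ ω, fderiv ℝ g (fun j => X (φ j) ω) (fun i => inner ℝ (0 : H) (φ i)) = 0 := by
      intro ω
      simp only [inner_zero_left]
      exact map_zero _
    simp only [this, integral_zero]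
    refine integral_eq_zero_of_ae ?_
    filter_upwards [h0] with ω hω
    simp [hω]
  have hn : ‖h‖ ≠ 0 := norm_ne_zero_iff.2 hh
  -- Regression coefficients of `X(φᵢ)` on `X(h)`: the residuals `Yᵢ` are uncorrelated with `X(h)`,
  -- hence jointly independent of it by Gaussianity.
  set a : Fin n → ℝ := fun i => inner ℝ h (φ i) / ‖h‖ ^ 2 with ha
  set Y : Fin n → Ω → ℝ := fun i ω => X (φ i) ω - a i * X h ω with hY
  -- `X h` is indexed by `Unit` because the covariance criterion for independence compares two
  -- families.
  have hlaw : HasGaussianLaw (fun ω => ((fun i => Y i ω), fun _ : Unit => X h ω)) P := by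
    have h1 := hX.hasGaussianLaw_pi (fun o : Option (Fin n) => o.elim h φ)
    let Lm : (Option (Fin n) → ℝ) →L[ℝ] (Fin n → ℝ) × (Unit → ℝ) :=
      (ContinuousLinearMap.pi fun i => ContinuousLinearMap.proj (some i) -
          a i • ContinuousLinearMap.proj none).prod
        (ContinuousLinearMap.pi fun _ => ContinuousLinearMap.proj none)
    exact h1.map_fun Lm
  have hind : IndepFun (fun ω i => Y i ω) (fun ω (_ : Unit) => X h ω) P := by
    refine hlaw.indepFun_of_covariance_eval (X := Y) (Y := fun _ => X h) fun i _ => ?_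
    have e : Y i = X (φ i) - fun ω => a i * X h ω := rfl
    rw [e, covariance_sub_left (hX.memLp _ (by simp)) ((hX.memLp _ (by simp)).const_mul _)
      (hX.memLp _ (by simp)), covariance_const_mul_left, hX.covariance_apply,
      hX.covariance_apply, real_inner_self_eq_norm_sq, ha, real_inner_comm]
    field_simp
    simp
  have hind' : IndepFun (fun ω i => Y i ω) (X h) P :=
    hind.comp (φ := id) (ψ := fun z : Unit → ℝ => z ()) measurable_id (measurable_pi_apply _)
  have hYm : AEMeasurable (fun ω i => Y i ω) P := hlaw.fst.aemeasurable
  have hZm : AEMeasurable (X h) P := hX.gaussian.aemeasurable h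
  have hprod := (indepFun_iff_map_prod_eq_prod_map_map hYm hZm).1 hind'
  rw [hX.map_eq] at hprod
  have hXY : ∀ ω, (fun j => X (φ j) ω) = (fun i => Y i ω) + X h ω • a := by
    intro ω; ext i; simp [hY, mul_comm]
  have hfa : ∀ x, fderiv ℝ g x (fun i => inner ℝ h (φ i)) = ‖h‖ ^ 2 * fderiv ℝ g x a := by
    intro x
    rw [← smul_eq_mul, ← map_smul]
    congr 1
    ext i
    simp [ha]
    field_simp
  have hcurve : ∀ y : Fin n → ℝ, (fun z : ℝ => y + z • a).HasTemperateGrowth := fun y =>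
    (Function.HasTemperateGrowth.const y).add
      (ContinuousLinearMap.toSpanSingleton ℝ a).hasTemperateGrowth
  have hid : HasGaussianLaw (id : ℝ → ℝ) (gaussianReal 0 (‖h‖₊ ^ 2)) :=
    IsGaussian.hasGaussianLaw_id
  -- With the residual frozen at `y`, Stein's identity applies along the line `y + z • a`; Fubini
  -- then integrates over `y`.
  have hstein : ∀ y : Fin n → ℝ,
      ∫ z, g (y + z • a) * z ∂gaussianReal 0 (‖h‖₊ ^ 2) =
        ‖h‖ ^ 2 * ∫ z, fderiv ℝ g (y + z • a) a ∂gaussianReal 0 (‖h‖₊ ^ 2) := by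
    intro y
    have t1 : (fun z : ℝ => g (y + z • a)).HasTemperateGrowth := hg.comp (hcurve y)
    have t2 : (fun z : ℝ => fderiv ℝ g (y + z • a) a).HasTemperateGrowth :=
      (hg.fderiv_apply a).comp (hcurve y)
    have := integral_mul_id_gaussianReal (‖h‖₊ ^ 2) (f := fun z => g (y + z • a))
      (f' := fun z => fderiv ℝ g (y + z • a) a) (fun z => ?_) (t1.integrable_comp hid)
      ((t1.mul Function.HasTemperateGrowth.id).integrable_comp hid) (t2.integrable_comp hid)
    · rw [this]; simp
    · have hd : HasDerivAt (fun z : ℝ => y + z • a) a z := by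
        simpa using ((hasDerivAt_id z).smul_const a).const_add y
      exact ((hg.1.differentiable (by simp)) _).hasFDerivAt.comp_hasDerivAt z hd
  have hcont1 : Continuous fun p : (Fin n → ℝ) × ℝ => g (p.1 + p.2 • a) * p.2 :=
    (hg.1.continuous.comp (by fun_prop)).mul continuous_snd
  have hcont2 : Continuous fun p : (Fin n → ℝ) × ℝ => fderiv ℝ g (p.1 + p.2 • a) a :=
    (hg.fderiv_apply a).1.continuous.comp (by fun_prop)
  have hYZ : AEMeasurable (fun ω => ((fun i => Y i ω), X h ω)) P := hYm.prodMk hZm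
  have e1 : ∫ ω, smoothVar X g φ ω * X h ω ∂P =
      ∫ p, g (p.1 + p.2 • a) * p.2 ∂(P.map (fun ω i => Y i ω)).prod
        (gaussianReal 0 (‖h‖₊ ^ 2)) := by
    rw [← hprod, integral_map hYZ hcont1.aestronglyMeasurable]
    simp_rw [smoothVar, hXY]
  have e2 : ∫ ω, fderiv ℝ g (fun j => X (φ j) ω) (fun i => inner ℝ h (φ i)) ∂P =
      ‖h‖ ^ 2 * ∫ p, fderiv ℝ g (p.1 + p.2 • a) a ∂(P.map (fun ω i => Y i ω)).prod
        (gaussianReal 0 (‖h‖₊ ^ 2)) := by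
    rw [← hprod, integral_map hYZ hcont2.aestronglyMeasurable, ← integral_const_mul]
    simp_rw [hfa, hXY]
  have : IsProbabilityMeasure (P.map (fun ω i => Y i ω)) :=
    Measure.isProbabilityMeasure_map hYm
  rw [e1, e2, integral_prod _ ?_, integral_prod _ ?_, ← integral_const_mul]
  · simp_rw [hstein]
  · rw [← hprod, integrable_map_measure hcont2.aestronglyMeasurable hYZ]
    have := (hg.fderiv_apply a).integrable_comp (hX.hasGaussianLaw_pi φ)
    simp_rw [hXY] at this
    exact this
  · rw [← hprod, integrable_map_measure hcont1.aestronglyMeasurable hYZ]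
    have := (hX.memLp_smoothVar hg φ (p := 2) (by simp)).integrable_mul
      (hX.memLp h (p := 2) (by simp))
    have e : ((fun p : (Fin n → ℝ) × ℝ => g (p.1 + p.2 • a) * p.2) ∘
        fun ω => ((fun i => Y i ω), X h ω)) = smoothVar X g φ * X h := by
      ext ω; simp [smoothVar, hXY]
    rw [e]
    exact this

end IsIsonormal

/-! ### Closability and uniqueness of the Malliavin derivative. -/

theorem MeasureTheory.MemLp.integrable_fun_mul {Ω : Type*} {mΩ : MeasurableSpace Ω}
    {P : Measure Ω} {f g : Ω → ℝ} (hf : MemLp f 2 P) (hg : MemLp g 2 P) :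
    Integrable (fun ω => f ω * g ω) P :=
  hf.integrable_mul hg

theorem tendsto_integral_mul_of_tendsto_eLpNorm {Ω : Type*} {mΩ : MeasurableSpace Ω}
    {P : Measure Ω} {f : ℕ → Ω → ℝ} {f₀ W : Ω → ℝ} (hf : ∀ n, MemLp (f n) 2 P)
    (hf₀ : MemLp f₀ 2 P) (hW : MemLp W 2 P)
    (h : Tendsto (fun n => eLpNorm (f n - f₀) 2 P) atTop (𝓝 0)) :
    Tendsto (fun n => ∫ ω, f n ω * W ω ∂P) atTop (𝓝 (∫ ω, f₀ ω * W ω ∂P)) := by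
  refine tendsto_integral_of_L1' _ (hf₀.integrable_fun_mul hW).1
    (Eventually.of_forall fun n => (hf n).integrable_fun_mul hW) ?_
  have hb : ∀ n, eLpNorm (fun ω => f n ω * W ω - f₀ ω * W ω) 1 P ≤
      eLpNorm (f n - f₀) 2 P * eLpNorm W 2 P := by
    intro n
    have := eLpNorm_smul_le_mul_eLpNorm (p := 2) (q := 2) (r := 1) hW.1 ((hf n).sub hf₀).1
    refine le_trans (le_of_eq ?_) this
    congr 1
    ext ω
    simp [sub_mul]
  refine tendsto_of_tendsto_of_tendsto_of_le_of_le tendsto_const_nhds ?_ (fun _ => zero_le)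
    hb
  simpa using ENNReal.Tendsto.mul_const h (Or.inr hW.2.ne)

namespace IsIsonormal

variable {Ω : Type*} {mΩ : MeasurableSpace Ω} {P : Measure Ω}
  {H : Type*} [NormedAddCommGroup H] [InnerProductSpace ℝ H] {X : H → Ω → ℝ}

/-- Integration by parts for a product of two smooth random variables. -/
theorem integral_smoothVar_mul_smoothVar_mul (hX : IsIsonormal X P) {m n : ℕ}
    {f : (Fin m → ℝ) → ℝ} (hf : f.HasTemperateGrowth) (φ : Fin m → H)
    {g : (Fin n → ℝ) → ℝ} (hg : g.HasTemperateGrowth) (ψ : Fin n → H) (h : H) :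
    ∫ ω, smoothVar X f φ ω * smoothVar X g ψ ω * X h ω ∂P =
      ∫ ω, smoothVar X f φ ω * inner ℝ h (smoothVarDeriv X g ψ ω) +
        smoothVar X g ψ ω * inner ℝ h (smoothVarDeriv X f φ ω) ∂P := by
  -- Concatenating the two argument lists makes the product a single smooth variable; the Leibniz
  -- rule then gives both terms.
  let p₁ : (Fin (m + n) → ℝ) →L[ℝ] (Fin m → ℝ) :=
    ContinuousLinearMap.pi fun i => ContinuousLinearMap.proj (Fin.castAdd n i)
  let p₂ : (Fin (m + n) → ℝ) →L[ℝ] (Fin n → ℝ) :=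
    ContinuousLinearMap.pi fun i => ContinuousLinearMap.proj (Fin.natAdd m i)
  have t₁ : (fun x => f (p₁ x)).HasTemperateGrowth := hf.comp p₁.hasTemperateGrowth
  have t₂ : (fun x => g (p₂ x)).HasTemperateGrowth := hg.comp p₂.hasTemperateGrowth
  have key := hX.integral_smoothVar_mul (t₁.mul t₂) (Fin.append φ ψ) h
  have q₁ : ∀ F : H → ℝ, p₁ (fun j => F (Fin.append φ ψ j)) = fun j => F (φ j) := by
    intro F; ext i; simp [p₁]
  have q₂ : ∀ F : H → ℝ, p₂ (fun j => F (Fin.append φ ψ j)) = fun j => F (ψ j) := by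
    intro F; ext i; simp [p₂]
  have e₁ : ∀ ω, smoothVar X ((fun x => f (p₁ x)) * fun x => g (p₂ x)) (Fin.append φ ψ) ω =
      smoothVar X f φ ω * smoothVar X g ψ ω := by
    intro ω
    simp only [smoothVar, Pi.mul_apply, q₁ (fun h => X h ω), q₂ (fun h => X h ω)]
  simp_rw [e₁] at key
  rw [key]
  refine integral_congr_ae (ae_of_all _ fun ω => ?_)
  simp only [inner_smoothVarDeriv]
  have d₁ : ∀ x, HasFDerivAt (fun x => f (p₁ x)) ((fderiv ℝ f (p₁ x)).comp p₁) x := fun x =>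
    ((hf.1.differentiable (by simp)) (p₁ x)).hasFDerivAt.comp x p₁.hasFDerivAt
  have d₂ : ∀ x, HasFDerivAt (fun x => g (p₂ x)) ((fderiv ℝ g (p₂ x)).comp p₂) x := fun x =>
    ((hg.1.differentiable (by simp)) (p₂ x)).hasFDerivAt.comp x p₂.hasFDerivAt
  rw [((d₁ _).mul (d₂ _)).fderiv]
  simp only [smoothVar, add_apply, smul_apply,
    ContinuousLinearMap.comp_apply, smul_eq_mul, q₁ (fun h => X h ω), q₂ (fun h => X h ω),
    q₁ (fun k => inner ℝ h k), q₂ (fun k => inner ℝ h k)]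

theorem memLp_inner {u : Ω → H} (hu : MemLp u 2 P) (h : H) :
    MemLp (fun ω => (inner ℝ h (u ω) : ℝ)) 2 P :=
  (innerSL ℝ h).comp_memLp' hu

theorem exists_seq_of_isMalliavinDeriv {F : Ω → ℝ} {u : Ω → H}
    (hu : IsMalliavinDeriv X P F u) (h : H) :
    ∃ (n : ℕ → ℕ) (g : (k : ℕ) → (Fin (n k) → ℝ) → ℝ) (φ : (k : ℕ) → Fin (n k) → H),
      (∀ k, (g k).HasTemperateGrowth) ∧
      Tendsto (fun k => eLpNorm (smoothVar X (g k) (φ k) - F) 2 P) atTop (𝓝 0) ∧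
      Tendsto (fun k => eLpNorm ((fun ω => (inner ℝ h (smoothVarDeriv X (g k) (φ k) ω) : ℝ)) -
        fun ω => (inner ℝ h (u ω) : ℝ)) 2 P) atTop (𝓝 0) := by
  obtain ⟨-, hu2, H⟩ := hu
  have hpos : ∀ k : ℕ, (0 : ℝ≥0∞) < (k : ℝ≥0∞)⁻¹ := fun k =>
    ENNReal.inv_pos.2 (ENNReal.natCast_ne_top k)
  choose n g φ hg h1 h2 using fun k : ℕ => H _ (hpos k)
  refine ⟨n, g, φ, hg, ?_, ?_⟩
  · refine tendsto_of_tendsto_of_tendsto_of_le_of_le tendsto_const_nhds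
      ENNReal.tendsto_inv_nat_nhds_zero (fun _ => zero_le) fun k => ?_
    rw [eLpNorm_sub_comm]
    exact (h1 k).le
  · have hlim : Tendsto (fun k : ℕ => ENNReal.ofReal ‖h‖ * (k : ℝ≥0∞)⁻¹) atTop (𝓝 0) := by
      simpa using ENNReal.Tendsto.const_mul ENNReal.tendsto_inv_nat_nhds_zero
        (Or.inr (ENNReal.ofReal_ne_top (r := ‖h‖)))
    refine tendsto_of_tendsto_of_tendsto_of_le_of_le tendsto_const_nhds
      hlim (fun _ => zero_le) fun k => ?_
    refine le_trans ?_ (mul_le_mul_right (h2 k).le _)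
    refine eLpNorm_le_mul_eLpNorm_of_ae_le_mul (ae_of_all _ fun ω => ?_) 2
    simp only [Pi.sub_apply]
    rw [← inner_sub_right, norm_sub_rev (u ω)]
    exact norm_inner_le_norm _ _

/-- Both sides pass to the limit from smooth variables. The right side does not involve `u`, so all
derivatives of `F` have the same pairing with smooth variables. -/
theorem integral_mul_inner_isMalliavinDeriv (hX : IsIsonormal X P) {F : Ω → ℝ} {u : Ω → H}
    (hu : IsMalliavinDeriv X P F u) (h : H) {m : ℕ}
    {f : (Fin m → ℝ) → ℝ} (hf : f.HasTemperateGrowth) (φ : Fin m → H) :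
    ∫ ω, inner ℝ h (u ω) * smoothVar X f φ ω ∂P =
      ∫ ω, F ω * (smoothVar X f φ ω * X h ω - inner ℝ h (smoothVarDeriv X f φ ω)) ∂P := by
  obtain ⟨n, g, ψ, hg, h1, h2⟩ := exists_seq_of_isMalliavinDeriv hu h
  have hfX : MemLp (fun ω => smoothVar X f φ ω * X h ω) 2 P := by
    have : ENNReal.HolderTriple 4 4 2 := ⟨by
      have : (4 : ℝ≥0∞) = 2 * 2 := by norm_num
      rw [this, ENNReal.mul_inv (by simp) (by simp), ← mul_add, ENNReal.inv_two_add_inv_two,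
        mul_one]⟩
    exact (hX.memLp h (p := 4) (by simp)).mul' (hX.memLp_smoothVar hf φ (p := 4) (by simp))
  have hDf := memLp_inner (hX.memLp_smoothVarDeriv hf φ (p := 2) (by simp)) h
  have l1 := tendsto_integral_mul_of_tendsto_eLpNorm
    (fun k => hX.memLp_smoothVar (hg k) (ψ k) (by simp)) hu.1 (hfX.sub hDf) h1
  have l2 := tendsto_integral_mul_of_tendsto_eLpNorm
    (fun k => memLp_inner (hX.memLp_smoothVarDeriv (hg k) (ψ k) (by simp)) h)
    (memLp_inner hu.2.1 h) (hX.memLp_smoothVar hf φ (p := 2) (by simp)) h2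
  refine tendsto_nhds_unique l2 (l1.congr fun k => ?_)
  have hG := hX.memLp_smoothVar (hg k) (ψ k) (p := 2) (by simp)
  have hDG := memLp_inner (hX.memLp_smoothVarDeriv (hg k) (ψ k) (p := 2) (by simp)) h
  have hS := hX.memLp_smoothVar hf φ (p := 2) (by simp)
  have key := hX.integral_smoothVar_mul_smoothVar_mul (hg k) (ψ k) hf φ h
  rw [integral_add (hG.integrable_fun_mul hDf) (hS.integrable_fun_mul hDG)] at key
  have e1 : ∫ ω, smoothVar X (g k) (ψ k) ω * ((fun ω => smoothVar X f φ ω * X h ω) -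
      fun ω => (inner ℝ h (smoothVarDeriv X f φ ω) : ℝ)) ω ∂P =
      ∫ ω, smoothVar X (g k) (ψ k) ω * smoothVar X f φ ω * X h ω ∂P -
        ∫ ω, smoothVar X (g k) (ψ k) ω * inner ℝ h (smoothVarDeriv X f φ ω) ∂P := by
    rw [← integral_sub ?_ (hG.integrable_fun_mul hDf)]
    · refine integral_congr_ae (ae_of_all _ fun ω => ?_)
      simp only [Pi.sub_apply]
      ring
    · refine (hG.integrable_fun_mul hfX).congr (ae_of_all _ fun ω => ?_)
      simp only
      ring
  rw [e1, key, add_sub_cancel_left]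
  exact integral_congr_ae (ae_of_all _ fun ω => mul_comm _ _)

theorem exists_smoothVar_eq_inner_smoothVarDeriv {n : ℕ} {g : (Fin n → ℝ) → ℝ}
    (hg : g.HasTemperateGrowth) (φ : Fin n → H) (h : H) :
    ∃ g' : (Fin n → ℝ) → ℝ, g'.HasTemperateGrowth ∧
      (fun ω => (inner ℝ h (smoothVarDeriv X g φ ω) : ℝ)) = smoothVar X g' φ :=
  ⟨_, hg.fderiv_apply (fun i => inner ℝ h (φ i)), funext fun ω => inner_smoothVarDeriv g φ h ω⟩

/-- The Malliavin derivative operator is closable. -/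
theorem isMalliavinDeriv_unique [CompleteSpace H] [TopologicalSpace.SeparableSpace H]
    (hX : IsIsonormal X P) {F : Ω → ℝ} {u v : Ω → H}
    (hu : IsMalliavinDeriv X P F u) (hv : IsMalliavinDeriv X P F v) : u =ᵐ[P] v := by
  have hw : ∀ h : H, MemLp (fun ω => (inner ℝ h (u ω) - inner ℝ h (v ω) : ℝ)) 2 P := fun h =>
    (memLp_inner hu.2.1 h).sub (memLp_inner hv.2.1 h)
  have horth : ∀ (h : H) {m : ℕ} {f : (Fin m → ℝ) → ℝ}, f.HasTemperateGrowth →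
      ∀ φ : Fin m → H, ∫ ω, smoothVar X f φ ω * (inner ℝ h (u ω) - inner ℝ h (v ω)) ∂P = 0 := by
    intro h m f hf φ
    have hS := hX.memLp_smoothVar hf φ (p := 2) (by simp)
    have e : ∀ ω, smoothVar X f φ ω * (inner ℝ h (u ω) - inner ℝ h (v ω)) =
        inner ℝ h (u ω) * smoothVar X f φ ω - inner ℝ h (v ω) * smoothVar X f φ ω := by
      intro ω; ring
    simp_rw [e]
    rw [integral_sub ((memLp_inner hu.2.1 h).integrable_fun_mul hS)
      ((memLp_inner hv.2.1 h).integrable_fun_mul hS),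
      hX.integral_mul_inner_isMalliavinDeriv hu h hf φ,
      hX.integral_mul_inner_isMalliavinDeriv hv h hf φ, sub_self]
  -- Smooth variables need not be dense in `L²(Ω)`. It suffices that `⟨h, w⟩` is an `L²` limit of
  -- smooth variables `⟨h, DG_k⟩`: taking `w = u` and `w = v` makes `⟨h, u - v⟩` orthogonal to
  -- itself.
  have hlim : ∀ (h : H) {w : Ω → H}, IsMalliavinDeriv X P F w →
      ∫ ω, inner ℝ h (w ω) * (inner ℝ h (u ω) - inner ℝ h (v ω)) ∂P = 0 := by
    intro h w hwd
    obtain ⟨n, g, ψ, hg, -, h2⟩ := exists_seq_of_isMalliavinDeriv hwd h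
    have l := tendsto_integral_mul_of_tendsto_eLpNorm
      (fun k => memLp_inner (hX.memLp_smoothVarDeriv (hg k) (ψ k) (by simp)) h)
      (memLp_inner hwd.2.1 h) (hw h) h2
    refine tendsto_nhds_unique l (tendsto_const_nhds.congr fun k => ?_)
    obtain ⟨g', hg', e⟩ := exists_smoothVar_eq_inner_smoothVarDeriv (X := X) (hg k) (ψ k) h
    have := horth h hg' (ψ k)
    rw [← e] at this
    exact this.symm
  have hzero : ∀ h : H, (fun ω => (inner ℝ h ((u - v) ω) : ℝ)) =ᵐ[P] 0 := by
    intro h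
    have e : ∫ ω, (inner ℝ h (u ω) - inner ℝ h (v ω)) *
        (inner ℝ h (u ω) - inner ℝ h (v ω)) ∂P = 0 := by
      have e' : ∀ ω, (inner ℝ h (u ω) - inner ℝ h (v ω) : ℝ) *
          (inner ℝ h (u ω) - inner ℝ h (v ω)) =
          inner ℝ h (u ω) * (inner ℝ h (u ω) - inner ℝ h (v ω)) -
          inner ℝ h (v ω) * (inner ℝ h (u ω) - inner ℝ h (v ω)) := by
        intro ω; ring
      simp_rw [e']
      rw [integral_sub ((memLp_inner hu.2.1 h).integrable_fun_mul (hw h))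
        ((memLp_inner hv.2.1 h).integrable_fun_mul (hw h)), hlim h hu, hlim h hv, sub_zero]
    rw [integral_eq_zero_iff_of_nonneg (fun ω => mul_self_nonneg _)
      ((hw h).integrable_fun_mul (hw h))] at e
    filter_upwards [e] with ω hω
    simpa [inner_sub_right] using hω
  -- The exceptional null set in `hzero` depends on `h`; separability of `H` reduces to countably
  -- many `h`.
  have := ae_eq_zero_of_forall_inner (𝕜 := ℝ) hzero
  filter_upwards [this] with ω hω
  simpa [sub_eq_zero] using hω

theorem malliavinDeriv_ae_eq [CompleteSpace H] [TopologicalSpace.SeparableSpace H]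
    (hX : IsIsonormal X P) {F : Ω → ℝ} {u : Ω → H}
    (hu : IsMalliavinDeriv X P F u) : malliavinDeriv X P F =ᵐ[P] u := by
  have h : ∃ u : Ω → H, IsMalliavinDeriv X P F u := ⟨u, hu⟩
  rw [malliavinDeriv, dif_pos h]
  exact hX.isMalliavinDeriv_unique h.choose_spec hu

theorem isMalliavinDeriv_congr {F G : Ω → ℝ} {u : Ω → H}
    (hu : IsMalliavinDeriv X P F u) (hFG : F =ᵐ[P] G) : IsMalliavinDeriv X P G u := by
  refine ⟨(memLp_congr_ae hFG).1 hu.1, hu.2.1, fun ε hε => ?_⟩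
  obtain ⟨n, g, φ, hg, h1, h2⟩ := hu.2.2 ε hε
  refine ⟨n, g, φ, hg, ?_, h2⟩
  rwa [← eLpNorm_congr_ae (hFG.sub (ae_eq_refl _))]

end IsIsonormal

/-! ### Hermite polynomials. -/

section Hermite

open Polynomial

theorem Polynomial.derivative_hermite_succ (n : ℕ) :
    derivative (hermite (n + 1)) = ((n : ℤ[X]) + 1) * hermite n := by
  induction n with
  | zero => simp
  | succ n ih =>
    rw [hermite_succ (n + 1), derivative_sub, derivative_mul, derivative_X, ih, derivative_mul,
      hermite_succ n]
    simp
    ring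

theorem Polynomial.hasTemperateGrowth_aeval {E : Type*} [NormedAddCommGroup E] [NormedSpace ℝ E]
    (p : ℤ[X]) {f : E → ℝ} (hf : f.HasTemperateGrowth) :
    (fun x => aeval (f x) p).HasTemperateGrowth := by
  induction p using Polynomial.induction_on' with
  | add p q hp hq => simpa using! hp.add hq
  | monomial n a =>
    simp only [aeval_monomial]
    exact (Function.HasTemperateGrowth.const _).mul (hf.pow n)

end Hermite

/-! ### The second chaos, its associated operators, and orthogonality to the other chaoses. -/

theorem MeasureTheory.MemLp.inner_toLp_eq_integral {Ω : Type*} {mΩ : MeasurableSpace Ω}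
    {P : Measure Ω} {f : Ω → ℝ} (hf : MemLp f 2 P) (F : Lp ℝ 2 P) :
    inner ℝ F (hf.toLp f) = ∫ ω, F ω * f ω ∂P := by
  rw [L2.inner_def]
  refine integral_congr_ae ?_
  filter_upwards [hf.coeFn_toLp] with ω hω
  simp [hω, mul_comm]

theorem MeasureTheory.MemLp.inner_toLp_toLp {Ω : Type*} {mΩ : MeasurableSpace Ω}
    {P : Measure Ω} {f g : Ω → ℝ} (hf : MemLp f 2 P) (hg : MemLp g 2 P) :
    inner ℝ (hf.toLp f) (hg.toLp g) = ∫ ω, f ω * g ω ∂P := by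
  rw [hg.inner_toLp_eq_integral]
  refine integral_congr_ae ?_
  filter_upwards [hf.coeFn_toLp] with ω hω
  simp [hω]

namespace IsIsonormal

variable {Ω : Type*} {mΩ : MeasurableSpace Ω} {P : Measure Ω}
  {H : Type*} [NormedAddCommGroup H] [InnerProductSpace ℝ H] {X : H → Ω → ℝ}

theorem memLp_mul (hX : IsIsonormal X P) (g h : H) {p : ℝ≥0∞} (hp : p ≠ ⊤) :
    MemLp (fun ω => X g ω * X h ω) p P := by
  have t : (fun x : Fin 2 → ℝ => x 0 * x 1).HasTemperateGrowth :=
    (ContinuousLinearMap.proj (R := ℝ) (φ := fun _ : Fin 2 => ℝ) 0).hasTemperateGrowth.mul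
    (ContinuousLinearMap.proj (R := ℝ) (φ := fun _ : Fin 2 => ℝ) 1).hasTemperateGrowth
  simpa [smoothVar] using! hX.memLp_smoothVar t ![g, h] hp

theorem add_ae (hX : IsIsonormal X P) (g h : H) :
    X (g + h) =ᵐ[P] fun ω => X g ω + X h ω := by
  have m := fun h : H => hX.memLp h (p := 2) (by simp)
  -- Linearity of `X` is not assumed: the covariance identity gives the difference zero norm in
  -- `L²`.
  have key : (m (g + h)).toLp = (m g).toLp + (m h).toLp := by
    rw [← sub_eq_zero, ← inner_self_eq_zero (𝕜 := ℝ)]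
    simp only [inner_sub_left, inner_sub_right, inner_add_left, inner_add_right,
      MemLp.inner_toLp_toLp, hX.covariance_eq]
    ring
  filter_upwards [(m (g + h)).coeFn_toLp, (m g).coeFn_toLp, (m h).coeFn_toLp,
    Lp.coeFn_add (m g).toLp (m h).toLp] with ω h1 h2 h3 h4
  rw [← h1, key, h4, Pi.add_apply, h2, h3]

theorem smul_ae (hX : IsIsonormal X P) (c : ℝ) (h : H) :
    X (c • h) =ᵐ[P] fun ω => c * X h ω := by
  have m := fun h : H => hX.memLp h (p := 2) (by simp)
  have key : (m (c • h)).toLp = c • (m h).toLp := by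
    rw [← sub_eq_zero, ← inner_self_eq_zero (𝕜 := ℝ)]
    simp only [inner_sub_left, inner_sub_right, inner_smul_left, inner_smul_right,
      MemLp.inner_toLp_toLp, hX.covariance_eq]
    simp
  filter_upwards [(m (c • h)).coeFn_toLp, (m h).coeFn_toLp,
    Lp.coeFn_smul c (m h).toLp] with ω h1 h2 h3
  rw [← h1, key, h3, Pi.smul_apply, h2, smul_eq_mul]

/-- Isserlis' formula for four variables. -/
theorem integral_mul_mul_mul (hX : IsIsonormal X P) (a b c d : H) :
    ∫ ω, X a ω * X b ω * X c ω * X d ω ∂P =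
      inner ℝ a b * inner ℝ c d + inner ℝ a c * inner ℝ b d + inner ℝ a d * inner ℝ b c := by
  let p : (i : Fin 3) → (Fin 3 → ℝ) →L[ℝ] ℝ := fun i =>
    ContinuousLinearMap.proj (R := ℝ) (φ := fun _ : Fin 3 => ℝ) i
  have t : (fun x : Fin 3 → ℝ => p 0 x * p 1 x * p 2 x).HasTemperateGrowth :=
    ((p 0).hasTemperateGrowth.mul (p 1).hasTemperateGrowth).mul (p 2).hasTemperateGrowth
  have d₀ : ∀ x, HasFDerivAt (fun x : Fin 3 → ℝ => p 0 x * p 1 x * p 2 x) _ x := fun x =>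
    ((p 0).hasFDerivAt.mul (p 1).hasFDerivAt).mul (p 2).hasFDerivAt
  have key := hX.integral_smoothVar_mul t ![a, b, c] d
  simp only [inner_smoothVarDeriv, (d₀ _).fderiv] at key
  simp [smoothVar, p] at key
  have := hX.gaussian.isProbabilityMeasure
  rw [key]
  have i := fun g h : H => (hX.memLp_mul g h (p := 1) (by simp)).integrable le_rfl
  have e : ∀ ω, X a ω * X b ω * inner ℝ d c +
      (X c ω * (X a ω * inner ℝ d b) + X c ω * (X b ω * inner ℝ d a)) =
      inner ℝ d c * (X a ω * X b ω) + (inner ℝ d b * (X a ω * X c ω) +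
        inner ℝ d a * (X b ω * X c ω)) := by
    intro ω; ring
  simp_rw [e]
  have i' : Integrable (fun ω => inner ℝ d b * (X a ω * X c ω) +
      inner ℝ d a * (X b ω * X c ω)) P := ((i a c).const_mul _).add ((i b c).const_mul _)
  rw [integral_add ((i a b).const_mul _) i',
    integral_add ((i a c).const_mul _) ((i b c).const_mul _), integral_const_mul,
    integral_const_mul, integral_const_mul, hX.covariance_eq, hX.covariance_eq,
    hX.covariance_eq, real_inner_comm c d, real_inner_comm b d, real_inner_comm a d]
  ring

/-- The product `X(g) X(h)` as an element of `L²`. -/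
noncomputable def mulLp (hX : IsIsonormal X P) (g h : H) : Lp ℝ 2 P :=
  (hX.memLp_mul g h (by simp)).toLp _

theorem mulLp_comm (hX : IsIsonormal X P) (g h : H) : hX.mulLp g h = hX.mulLp h g := by
  simp only [mulLp, mul_comm]

theorem mulLp_add (hX : IsIsonormal X P) (g h h' : H) :
    hX.mulLp g (h + h') = hX.mulLp g h + hX.mulLp g h' := by
  rw [mulLp, mulLp, mulLp, ← MemLp.toLp_add, MemLp.toLp_eq_toLp_iff]
  filter_upwards [hX.add_ae h h'] with ω hω
  simp [hω, mul_add]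

theorem mulLp_smul (hX : IsIsonormal X P) (c : ℝ) (g h : H) :
    hX.mulLp g (c • h) = c • hX.mulLp g h := by
  rw [mulLp, mulLp, ← MemLp.toLp_const_smul, MemLp.toLp_eq_toLp_iff]
  filter_upwards [hX.smul_ae c h] with ω hω
  simp [hω, mul_left_comm]

/-- Isserlis' formula gives the squared norm `‖g‖²‖h‖² + 2⟨g, h⟩² ≤ 3‖g‖²‖h‖²`; the constant 2 is a
convenient bound for `√3`. -/
theorem norm_mulLp_le (hX : IsIsonormal X P) (g h : H) : ‖hX.mulLp g h‖ ≤ 2 * ‖g‖ * ‖h‖ := by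
  refine le_of_sq_le_sq ?_ (by positivity)
  rw [← real_inner_self_eq_norm_sq, mulLp, MemLp.inner_toLp_toLp]
  have := hX.integral_mul_mul_mul g h g h
  simp_rw [mul_assoc] at this ⊢
  rw [this]
  have h1 := abs_real_inner_le_norm g h
  have h2 : (inner ℝ g h : ℝ) * inner ℝ g h ≤ (‖g‖ * ‖h‖) * (‖g‖ * ‖h‖) := by
    rw [← abs_mul_abs_self]
    exact mul_self_le_mul_self (abs_nonneg _) h1
  rw [real_inner_self_eq_norm_sq, real_inner_self_eq_norm_sq, real_inner_comm g h]
  nlinarith [mul_self_nonneg (‖g‖ * ‖h‖)]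

/-- The product `X(g) X(h)` as a bounded bilinear map into `L²`. -/
noncomputable def mulL (hX : IsIsonormal X P) : H →L[ℝ] H →L[ℝ] Lp ℝ 2 P :=
  LinearMap.mkContinuous₂
    (LinearMap.mk₂ ℝ hX.mulLp
      (fun g g' h => by rw [hX.mulLp_comm, hX.mulLp_add, hX.mulLp_comm h, hX.mulLp_comm h])
      (fun c g h => by rw [hX.mulLp_comm, hX.mulLp_smul, hX.mulLp_comm h])
      hX.mulLp_add fun c g h => hX.mulLp_smul c g h) 2 fun g h => hX.norm_mulLp_le g h

theorem mulL_apply (hX : IsIsonormal X P) (g h : H) : hX.mulL g h = hX.mulLp g h := rfl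

section Operator

variable [CompleteSpace H]

/-- The operator `A_F` with `⟨A_F g, h⟩ = E[F X(g) X(h)] / 2`, as a function of `F`. -/
noncomputable def chaosOperator (hX : IsIsonormal X P) : Lp ℝ 2 P →L[ℝ] H →L[ℝ] H :=
  LinearMap.mkContinuous₂
    (LinearMap.mk₂ ℝ (fun F g => (2⁻¹ : ℝ) • ContinuousLinearMap.adjoint (hX.mulL g) F)
      (fun F F' g => by rw [map_add, smul_add]) (fun c F g => by rw [map_smul, smul_comm])
      (fun F g g' => by rw [map_add, map_add, add_apply, smul_add])
      (fun c F g => by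
        rw [map_smul, map_smulₛₗ, smul_apply, smul_comm, conj_trivial])) (2⁻¹ * ‖hX.mulL‖)
    (fun F g => by
      simp only [LinearMap.mk₂_apply]
      rw [norm_smul, mul_assoc, mul_assoc]
      simp only [norm_inv, Real.norm_ofNat]
      gcongr
      refine (ContinuousLinearMap.le_opNorm _ _).trans ?_
      rw [LinearIsometryEquiv.norm_map, mul_comm ‖F‖, ← mul_assoc]
      gcongr
      exact hX.mulL.le_opNorm g)

theorem inner_chaosOperator (hX : IsIsonormal X P) (F : Lp ℝ 2 P) (g h : H) :
    inner ℝ (hX.chaosOperator F g) h = 2⁻¹ * inner ℝ F (hX.mulLp g h) := by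
  change inner ℝ ((2⁻¹ : ℝ) • ContinuousLinearMap.adjoint (hX.mulL g) F) h = _
  rw [real_inner_smul_left, ContinuousLinearMap.adjoint_inner_left, mulL_apply]

theorem isSymmetric_chaosOperator (hX : IsIsonormal X P) (F : Lp ℝ 2 P) :
    (hX.chaosOperator F).IsSymmetric := fun g h => by
  change inner ℝ (hX.chaosOperator F g) h = inner ℝ g (hX.chaosOperator F h)
  rw [real_inner_comm (hX.chaosOperator F h) g, inner_chaosOperator, inner_chaosOperator,
    mulLp_comm]

end Operator

theorem integral_mul_aeval (hX : IsIsonormal X P) (g h : H) (p : Polynomial ℤ) :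
    ∫ ω, X g ω * Polynomial.aeval (X h ω) p ∂P =
      inner ℝ g h * ∫ ω, Polynomial.aeval (X h ω) p.derivative ∂P := by
  let q : (Fin 1 → ℝ) →L[ℝ] ℝ := ContinuousLinearMap.proj 0
  have t := Polynomial.hasTemperateGrowth_aeval p q.hasTemperateGrowth
  have d : ∀ x, HasFDerivAt (fun x => Polynomial.aeval (q x) p) _ x := fun x =>
    (p.hasDerivAt_aeval (q x)).comp_hasFDerivAt x q.hasFDerivAt
  have key := hX.integral_smoothVar_mul t ![h] g
  simp only [inner_smoothVarDeriv, (d _).fderiv] at key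
  simp [smoothVar, q, integral_mul_const] at key
  simp_rw [mul_comm (X g _)]
  rw [key, mul_comm]

/-- Two integrations by parts. The second derivative on the right is what separates the second chaos
from the others when `p` is a Hermite polynomial. -/
theorem integral_sq_mul_aeval (hX : IsIsonormal X P) (g h : H) (p : Polynomial ℤ) :
    ∫ ω, (X g ω) ^ 2 * Polynomial.aeval (X h ω) p ∂P =
      ‖g‖ ^ 2 * ∫ ω, Polynomial.aeval (X h ω) p ∂P +
      inner ℝ g h ^ 2 * ∫ ω, Polynomial.aeval (X h ω) p.derivative.derivative ∂P := by
  let q : (Fin 1 → ℝ) →L[ℝ] ℝ := ContinuousLinearMap.proj 0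
  have t := Polynomial.hasTemperateGrowth_aeval p q.hasTemperateGrowth
  have t' := Polynomial.hasTemperateGrowth_aeval p.derivative q.hasTemperateGrowth
  have d : ∀ x, HasFDerivAt (fun x => Polynomial.aeval (q x) p) _ x := fun x =>
    (p.hasDerivAt_aeval (q x)).comp_hasFDerivAt x q.hasFDerivAt
  have key := hX.integral_smoothVar_mul_smoothVar_mul q.hasTemperateGrowth ![g] t ![h] g
  have m1 := hX.memLp_smoothVar t ![h] (p := 1) (by simp)
  have m2 := hX.memLp_smoothVar t' ![h] (p := 2) (by simp)
  simp only [inner_smoothVarDeriv, (d _).fderiv, q.fderiv] at key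
  simp [smoothVar, q] at key m1 m2
  have e : ∀ ω, X g ω ^ 2 * Polynomial.aeval (X h ω) p =
      X g ω * Polynomial.aeval (X h ω) p * X g ω := by intro ω; ring
  simp_rw [e]
  have e' : ∀ ω, X g ω * (Polynomial.aeval (X h ω) p.derivative * inner ℝ g h) =
      inner ℝ g h * (X g ω * Polynomial.aeval (X h ω) p.derivative) := by intro ω; ring
  simp_rw [e'] at key
  rw [key, integral_add, integral_const_mul, hX.integral_mul_aeval, integral_mul_const]
  · ring
  · exact ((hX.memLp g (by simp)).integrable_fun_mul m2).const_mul _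
  · exact (memLp_one_iff_integrable.1 m1).mul_const _

theorem memLp_aeval (hX : IsIsonormal X P) (h : H) (p : Polynomial ℤ) {r : ℝ≥0∞} (hr : r ≠ ⊤) :
    MemLp (fun ω => Polynomial.aeval (X h ω) p) r P := by
  let q : (Fin 1 → ℝ) →L[ℝ] ℝ := ContinuousLinearMap.proj 0
  have t := Polynomial.hasTemperateGrowth_aeval p q.hasTemperateGrowth
  simpa [smoothVar, q] using! hX.memLp_smoothVar t ![h] hr

section ChaosVar

variable [IsProbabilityMeasure P]

theorem memLp_sq_sub_one (hX : IsIsonormal X P) (h : H) {p : ℝ≥0∞} (hp : p ≠ ⊤) :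
    MemLp (fun ω => X h ω ^ 2 - 1) p P := by
  simp_rw [sq]
  exact (hX.memLp_mul h h hp).sub (memLp_const 1)

/-- The random variable `X(h)² - 1` as an element of `L²`. -/
noncomputable def chaosVar (hX : IsIsonormal X P) (h : H) : Lp ℝ 2 P :=
  (hX.memLp_sq_sub_one h (by simp)).toLp _

theorem aeval_hermite_two (x : ℝ) : Polynomial.aeval x (Polynomial.hermite 2) = x ^ 2 - 1 := by
  rw [Polynomial.hermite_succ, Polynomial.hermite_one]
  simp [sq]

theorem chaosVar_mem (hX : IsIsonormal X P) {h : H} (hh : ‖h‖ = 1) :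
    hX.chaosVar h ∈ wienerChaos X P 2 := by
  refine Submodule.le_topologicalClosure _ (Submodule.subset_span ⟨h, hh, ?_⟩)
  filter_upwards [(hX.memLp_sq_sub_one h (p := 2) (by simp)).coeFn_toLp] with ω hω
  rw [aeval_hermite_two, ← hω]
  rfl

/-- The induction principle for the second chaos: a property defining a closed subspace need only be
checked on the generators `X(h)² - 1`. -/
theorem wienerChaos_two_le (hX : IsIsonormal X P) {K : Submodule ℝ (Lp ℝ 2 P)}
    (hK : IsClosed (K : Set (Lp ℝ 2 P))) (h : ∀ h : H, ‖h‖ = 1 → hX.chaosVar h ∈ K) :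
    wienerChaos X P 2 ≤ K := by
  refine Submodule.topologicalClosure_minimal _ (Submodule.span_le.2 ?_) hK
  rintro Y ⟨g, hg, hY⟩
  have : Y = hX.chaosVar g := by
    refine Lp.ext ?_
    filter_upwards [hY, (hX.memLp_sq_sub_one g (p := 2) (by simp)).coeFn_toLp] with ω h1 h2
    rw [h1, aeval_hermite_two, chaosVar, h2]
  rw [this]
  exact h g hg

theorem inner_chaosVar_mulLp (hX : IsIsonormal X P) {h : H} (hh : ‖h‖ = 1) (g g' : H) :
    inner ℝ (hX.chaosVar h) (hX.mulLp g g') = 2 * inner ℝ h g * inner ℝ h g' := by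
  have hm := hX.memLp_sq_sub_one h (p := 2) (by simp)
  have e : ∀ ω, (X h ω ^ 2 - 1) * (X g ω * X g' ω) =
      (X h ω * X h ω) * (X g ω * X g' ω) - X g ω * X g' ω := by
    intro ω; ring
  rw [mulLp, chaosVar, MemLp.inner_toLp_toLp]
  simp_rw [e]
  rw [integral_sub ((hX.memLp_mul h h (by simp)).integrable_fun_mul (hX.memLp_mul g g' (by simp)))
    ((hX.memLp_mul g g' (p := 1) (by simp)).integrable le_rfl), hX.covariance_eq]
  have := hX.integral_mul_mul_mul h h g g'
  simp_rw [mul_assoc (X h _ * X h _)] at this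
  rw [this, real_inner_self_eq_norm_sq, hh]
  ring

theorem inner_chaosVar_chaosVar (hX : IsIsonormal X P) {g : H} (hg : ‖g‖ = 1) (h : H) :
    inner ℝ (hX.chaosVar g) (hX.chaosVar h) = 2 * (inner ℝ g h) ^ 2 := by
  have h1 := hX.inner_chaosVar_mulLp hg h h
  rw [chaosVar, mulLp, MemLp.inner_toLp_toLp] at h1
  rw [chaosVar, chaosVar, MemLp.inner_toLp_toLp]
  have e : ∀ ω, (X g ω ^ 2 - 1) * (X h ω ^ 2 - 1) =
      (X g ω ^ 2 - 1) * (X h ω * X h ω) - (X g ω * X g ω - 1) := by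
    intro ω; ring
  simp_rw [e]
  have i := (hX.memLp_mul g g (p := 1) (by simp)).integrable le_rfl
  have i' : Integrable (fun ω => X g ω * X g ω - 1) P := i.sub (integrable_const 1)
  rw [integral_sub ((hX.memLp_sq_sub_one g (by simp)).integrable_fun_mul
    (hX.memLp_mul h h (by simp))) i', h1,
    integral_sub i (integrable_const 1), hX.covariance_eq, real_inner_self_eq_norm_sq, hg]
  simp
  ring

theorem chaosOperator_chaosVar [CompleteSpace H] (hX : IsIsonormal X P) {h : H} (hh : ‖h‖ = 1) :
    hX.chaosOperator (hX.chaosVar h) =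
      (ContinuousLinearMap.toSpanSingleton ℝ h).comp (innerSL ℝ h) := by
  ext g
  refine ext_inner_right ℝ fun g' => ?_
  rw [inner_chaosOperator, inner_chaosVar_mulLp hX hh]
  simp [real_inner_smul_left]
  ring

/-- A generator `X(h)² - 1` gives the rank-one projection onto `h`, and compact operators form a
closed subspace. -/
theorem isCompactOperator_chaosOperator [CompleteSpace H] (hX : IsIsonormal X P)
    {F : Lp ℝ 2 P} (hF : F ∈ wienerChaos X P 2) : IsCompactOperator (hX.chaosOperator F) := by
  have hle : wienerChaos X P 2 ≤ (compactOperator (RingHom.id ℝ) H H).comap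
      (hX.chaosOperator : Lp ℝ 2 P →ₗ[ℝ] H →L[ℝ] H) := by
    refine hX.wienerChaos_two_le ?_ fun h hh => ?_
    · exact isClosed_setOfPred_isCompactOperator.preimage hX.chaosOperator.continuous
    · change IsCompactOperator (hX.chaosOperator (hX.chaosVar h))
      rw [hX.chaosOperator_chaosVar hh]
      exact IsCompactOperator.clm_comp (f := innerSL ℝ h)
        (isCompactOperator_of_locallyCompactSpace_dom _)
        (ContinuousLinearMap.toSpanSingleton ℝ h)
  exact hle hF

theorem integral_aeval_hermite (hX : IsIsonormal X P) {h : H} (hh : ‖h‖ = 1) (n : ℕ) :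
    ∫ ω, Polynomial.aeval (X h ω) (Polynomial.hermite (n + 1)) ∂P = 0 := by
  simp_rw [Polynomial.hermite_succ, map_sub, map_mul, Polynomial.aeval_X]
  rw [integral_sub ((hX.memLp h (by simp)).integrable_fun_mul (hX.memLp_aeval h _ (by simp)))
    ((hX.memLp_aeval h _ (r := 1) (by simp)).integrable le_rfl), hX.integral_mul_aeval,
    real_inner_self_eq_norm_sq, hh]
  ring

/-- Both terms produced by integration by parts are means of Hermite polynomials: of `H_{n+1}`, and
of a multiple of `H_{n-1}` (zero when `n = 0`). They vanish unless `n = 1`, where `H_0 = 1` appears.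
-/
theorem inner_chaosVar_hermite (hX : IsIsonormal X P) (g : H) {h : H} (hh : ‖h‖ = 1)
    {n : ℕ} (hn : n ≠ 1) {Y : Lp ℝ 2 P}
    (hY : ∀ᵐ ω ∂P, Y ω = Polynomial.aeval (X h ω) (Polynomial.hermite (n + 1))) :
    inner ℝ Y (hX.chaosVar g) = 0 := by
  have hm := hX.memLp_aeval h (Polynomial.hermite (n + 1)) (r := 2) (by simp)
  have hm1 := (hX.memLp_aeval h (Polynomial.hermite (n + 1)) (r := 1) (by simp)).integrable le_rfl
  rw [chaosVar, MemLp.inner_toLp_eq_integral]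
  have e : ∫ ω, Y ω * (X g ω ^ 2 - 1) ∂P =
      ∫ ω, X g ω ^ 2 * Polynomial.aeval (X h ω) (Polynomial.hermite (n + 1)) -
        Polynomial.aeval (X h ω) (Polynomial.hermite (n + 1)) ∂P := by
    refine integral_congr_ae ?_
    filter_upwards [hY] with ω hω
    rw [hω]; ring
  have i : Integrable (fun ω => X g ω ^ 2 *
      Polynomial.aeval (X h ω) (Polynomial.hermite (n + 1))) P := by
    have := (hX.memLp_mul g g (p := 2) (by simp)).integrable_fun_mul hm
    simpa only [sq] using this
  rw [e, integral_sub i hm1, hX.integral_sq_mul_aeval, hX.integral_aeval_hermite hh,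
    Polynomial.derivative_hermite_succ]
  rcases n with _ | _ | n
  · simp
  · exact absurd rfl hn
  · have : Polynomial.derivative (((n + 1 + 1 - 1 + 1 : ℕ) : Polynomial ℤ) + 1) = 0 := by simp
    have e2 : Polynomial.derivative ((((n + 1 + 1 : ℕ) : Polynomial ℤ) + 1) *
        Polynomial.hermite (n + 1 + 1)) =
        Polynomial.C (((n : ℤ) + 3) * ((n : ℤ) + 2)) * Polynomial.hermite (n + 1) := by
      rw [Polynomial.derivative_mul, Polynomial.derivative_hermite_succ]
      simp
      ring
    rw [e2]
    simp only [map_mul, Polynomial.aeval_C, integral_const_mul, hX.integral_aeval_hermite hh]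
    simp

theorem wienerChaos_orthogonal (hX : IsIsonormal X P) {n : ℕ} (hn : n ≠ 1) :
    wienerChaos X P 2 ≤ (wienerChaos X P (n + 1))ᗮ := by
  refine hX.wienerChaos_two_le (Submodule.isClosed_orthogonal _) fun g _ => ?_
  rw [wienerChaos, Submodule.orthogonal_closure, Submodule.mem_orthogonal]
  intro Y hY
  induction hY using Submodule.span_induction with
  | mem Y hY =>
    obtain ⟨h, hh, hY⟩ := hY
    exact hX.inner_chaosVar_hermite g hh hn hY
  | zero => simp
  | add Y Z _ _ hY hZ => rw [inner_add_left, hY, hZ, add_zero]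
  | smul c Y _ hY => rw [inner_smul_left, hY, mul_zero]

theorem pseudoInverseL_eq (hX : IsIsonormal X P) {F : Lp ℝ 2 P} (hF : F ∈ wienerChaos X P 2) :
    pseudoInverseL X P F = -((2⁻¹ : ℝ) • F) := by
  rw [pseudoInverseL, tsum_eq_single 1]
  · rw [Submodule.starProjection_eq_self_iff.2 hF]
    norm_num
  · intro n hn
    rw [(Submodule.starProjection_apply_eq_zero_iff _).2 (hX.wienerChaos_orthogonal hn hF), smul_zero]

theorem integral_eq_zero_of_mem_wienerChaos (hX : IsIsonormal X P) {F : Lp ℝ 2 P}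
    (hF : F ∈ wienerChaos X P 2) : ∫ ω, F ω ∂P = 0 := by
  have m : MemLp (fun _ : Ω => (1 : ℝ)) 2 P := memLp_const 1
  have hle : wienerChaos X P 2 ≤ (Submodule.span ℝ {m.toLp})ᗮ := by
    refine hX.wienerChaos_two_le (Submodule.isClosed_orthogonal _) fun g hg => ?_
    rw [Submodule.mem_orthogonal_singleton_iff_inner_left, chaosVar, MemLp.inner_toLp_toLp]
    have := hX.integral_aeval_hermite hg 1
    simp_rw [one_add_one_eq_two, aeval_hermite_two] at this
    simpa using this
  have := Submodule.mem_orthogonal_singleton_iff_inner_left.1 (hle hF)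
  rw [m.inner_toLp_eq_integral] at this
  simpa using this

end ChaosVar

end IsIsonormal

/-! ### Eigenvectors of compact symmetric operators and summability of eigenvalues. -/

section Spectral

/-- A compact symmetric operator has an orthonormal family of eigenvectors with trivial
orthogonal complement. -/
theorem ContinuousLinearMap.exists_orthonormal_eigenvectors.{u} {E : Type u} [NormedAddCommGroup E]
    [InnerProductSpace ℝ E] [CompleteSpace E] {T : E →L[ℝ] E} (hT : IsCompactOperator T)
    (hT' : T.IsSymmetric) :
    ∃ (ι : Type u) (e : ι → E) (lam : ι → ℝ), Orthonormal ℝ e ∧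
      (Submodule.span ℝ (range e))ᗮ = ⊥ ∧ ∀ i, T (e i) = lam i • e i := by
  have hbot := ContinuousLinearMap.orthogonalComplement_iSup_eigenspaces_eq_bot hT hT'
  let V : ℝ → Submodule ℝ E := fun μ => Module.End.eigenspace (T : Module.End ℝ E) μ
  have hclosed : ∀ μ, IsClosed (V μ : Set E) := by
    intro μ
    have : (V μ : Set E) = {x | T x = μ • x} := by
      ext x; exact Module.End.mem_eigenspace_iff
    rw [this]
    exact isClosed_eq T.continuous (continuous_const_smul μ)
  have hcomplete : ∀ μ, CompleteSpace (V μ) := fun μ => (hclosed μ).completeSpace_coe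
  -- Hilbert bases of the eigenspaces are put together. Eigenspaces of distinct eigenvalues are
  -- orthogonal, and a vector orthogonal to all the chosen ones is orthogonal to every eigenspace.
  choose w b hb using fun μ => exists_hilbertBasis ℝ (V μ)
  refine ⟨Σ μ, w μ, fun i => ((b i.1 i.2 : V i.1) : E), fun i => i.1, ?_, ?_, ?_⟩
  · exact hT'.orthogonalFamily_eigenspaces.orthonormal_sigma_orthonormal fun μ => (b μ).orthonormal
  · rw [eq_bot_iff, ← hbot]
    intro x hx
    rw [Submodule.mem_orthogonal] at hx
    rw [← Submodule.iInf_orthogonal, Submodule.mem_iInf]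
    intro μ
    rw [Submodule.mem_orthogonal]
    intro y hy
    have hs := ((b μ).hasSum_repr ⟨y, hy⟩).mapL (V μ).subtypeL
    have hs2 := hs.mapL (innerSL ℝ x)
    have hz : ∀ i, innerSL ℝ x ((V μ).subtypeL ((b μ).repr ⟨y, hy⟩ i • b μ i)) = 0 := by
      intro i
      have := hx _ (Submodule.subset_span ⟨⟨μ, i⟩, rfl⟩)
      simp only [map_smul]
      rw [innerSL_apply_apply, real_inner_comm]
      simp [this]
    simp_rw [hz] at hs2
    have := hs2.unique hasSum_zero
    rw [real_inner_comm]
    simpa using this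
  · intro i
    exact Module.End.mem_eigenspace_iff.1 (b i.1 i.2).2

theorem Orthonormal.summable_smul {E : Type*} [NormedAddCommGroup E]
    [InnerProductSpace ℝ E] [CompleteSpace E] {ι : Type*} {v : ι → E} (hv : Orthonormal ℝ v)
    {a : ι → ℝ} (ha : Summable fun i => a i ^ 2) : Summable fun i => a i • v i := by
  have := hv.orthogonalFamily.summable_iff_norm_sq_summable a
  simp only [LinearIsometry.toSpanSingleton_apply, Real.norm_eq_abs, sq_abs] at this
  exact this.2 ha

theorem summable_pow_of_summable_sq {ι : Type*} {a : ι → ℝ} (ha : Summable fun i => a i ^ 2)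
    {n : ℕ} (hn : 2 ≤ n) : Summable fun i => a i ^ n := by
  obtain ⟨m, rfl⟩ := Nat.exists_eq_add_of_le hn
  refine Summable.of_norm_bounded (ha.mul_left (Real.sqrt (∑' i, a i ^ 2) ^ m)) fun i => ?_
  have h1 : |a i| ≤ Real.sqrt (∑' i, a i ^ 2) :=
    Real.abs_le_sqrt (ha.le_tsum i fun j _ => sq_nonneg _)
  rw [norm_pow, Real.norm_eq_abs, pow_add, sq_abs, mul_comm]
  gcongr

end Spectral

/-! ### Diagonalization of the second chaos. -/

namespace IsIsonormal

variable {Ω : Type*} {mΩ : MeasurableSpace Ω} {P : Measure Ω}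
  {H : Type*} [NormedAddCommGroup H] [InnerProductSpace ℝ H] {X : H → Ω → ℝ}
  {ι : Type*} {e : ι → H}

theorem memLp_smul_const (hX : IsIsonormal X P) (h : H) : MemLp (fun ω => X h ω • h) 2 P :=
  (ContinuousLinearMap.toSpanSingleton ℝ h).comp_memLp' (hX.memLp h (by simp))

/-- The random vector `X(h) h` as an element of `L²(Ω; H)`. -/
noncomputable def vecVar (hX : IsIsonormal X P) (h : H) : Lp H 2 P :=
  (hX.memLp_smul_const h).toLp _

theorem coeFn_vecVar (hX : IsIsonormal X P) (h : H) :
    hX.vecVar h =ᵐ[P] fun ω => X h ω • h := MemLp.coeFn_toLp _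

theorem inner_vecVar (hX : IsIsonormal X P) (g h : H) :
    inner ℝ (hX.vecVar g) (hX.vecVar h) = (inner ℝ g h) ^ 2 := by
  rw [L2.inner_def, sq]
  conv_rhs => rw [← hX.covariance_eq g h, ← integral_mul_const, hX.covariance_eq]
  refine integral_congr_ae ?_
  filter_upwards [hX.coeFn_vecVar g, hX.coeFn_vecVar h] with ω h1 h2
  rw [h1, h2, real_inner_smul_left, real_inner_smul_right]
  ring

theorem orthonormal_vecVar (hX : IsIsonormal X P) (he : Orthonormal ℝ e) :
    Orthonormal ℝ fun i => hX.vecVar (e i) := by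
  classical
  rw [orthonormal_iff_ite]
  intro i j
  rw [inner_vecVar, orthonormal_iff_ite.1 he]
  split_ifs <;> simp

theorem coeFn_sum_smul {E : Type*} [NormedAddCommGroup E] [NormedSpace ℝ E] (s : Finset ι)
    (a : ι → ℝ) {f : ι → Lp E 2 P} {g : ι → Ω → E} (h : ∀ i, f i =ᵐ[P] g i) :
    ((∑ i ∈ s, a i • f i : Lp E 2 P) : Ω → E) =ᵐ[P] fun ω => ∑ i ∈ s, a i • g i ω := by
  classical
  induction s using Finset.induction_on with
  | empty => simpa only [Finset.sum_empty] using! Lp.coeFn_zero E 2 P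
  | insert i s hi ih =>
    rw [Finset.sum_insert hi]
    filter_upwards [ih, h i, Lp.coeFn_add (a i • f i) (∑ i ∈ s, a i • f i),
      Lp.coeFn_smul (a i) (f i)] with ω h1 h2 h3 h4
    rw [h3, Pi.add_apply, h1, h4, Pi.smul_apply, h2, Finset.sum_insert hi]

variable [IsProbabilityMeasure P]

theorem orthonormal_chaosVar (hX : IsIsonormal X P) (he : Orthonormal ℝ e) :
    Orthonormal ℝ fun i => (Real.sqrt 2)⁻¹ • hX.chaosVar (e i) := by
  classical
  rw [orthonormal_iff_ite]
  intro i j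
  rw [real_inner_smul_left, real_inner_smul_right, hX.inner_chaosVar_chaosVar (he.1 i),
    orthonormal_iff_ite.1 he]
  split_ifs
  · field_simp; simp
  · simp

theorem summable_chaosVar (hX : IsIsonormal X P) (he : Orthonormal ℝ e) {a : ι → ℝ}
    (ha : Summable fun i => a i ^ 2) : Summable fun i => a i • hX.chaosVar (e i) := by
  have h := (hX.orthonormal_chaosVar he).summable_smul (a := fun i => Real.sqrt 2 * a i)
    (by simpa [mul_pow] using ha.mul_left 2)
  refine h.congr fun i => ?_
  rw [smul_smul]
  congr 1
  field_simp

/-- For orthonormal `eᵢ` the variables `X(eᵢ)² - 1` are orthogonal with squared norm 2, the source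
of the factor 2. -/
theorem inner_hasSum_chaosVar (hX : IsIsonormal X P) (he : Orthonormal ℝ e) {a b : ι → ℝ}
    {Q R : Lp ℝ 2 P} (hQ : HasSum (fun i => a i • hX.chaosVar (e i)) Q)
    (hR : HasSum (fun i => b i • hX.chaosVar (e i)) R) :
    HasSum (fun i => 2 * (a i * b i)) (inner ℝ Q R) := by
  classical
  have h1 : ∀ j, inner ℝ Q (hX.chaosVar (e j)) = 2 * a j := by
    intro j
    have := hQ.mapL (innerSL ℝ (hX.chaosVar (e j)))
    rw [innerSL_apply_apply] at this
    rw [real_inner_comm]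
    refine this.unique ?_
    convert! hasSum_ite_eq j (2 * a j) using 2 with i
    rw [innerSL_apply_apply, real_inner_smul_right, hX.inner_chaosVar_chaosVar (he.1 j),
      orthonormal_iff_ite.1 he]
    by_cases hij : i = j
    · simp [hij, mul_comm]
    · simp [hij, Ne.symm hij]
  have := hR.mapL (innerSL ℝ Q)
  rw [innerSL_apply_apply] at this
  refine this.congr_fun ?_
  intro i
  rw [innerSL_apply_apply, real_inner_smul_right, h1]
  ring

/-- Elements of the second chaos diagonalize: `F = ∑ λᵢ (X(eᵢ)² - 1)`. -/
theorem exists_hasSum_chaosVar.{u} {H : Type u} [NormedAddCommGroup H] [InnerProductSpace ℝ H]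
    [CompleteSpace H] {X : H → Ω → ℝ} (hX : IsIsonormal X P) {F : Lp ℝ 2 P}
    (hF : F ∈ wienerChaos X P 2) :
    ∃ (ι : Type u) (e : ι → H) (lam : ι → ℝ), Orthonormal ℝ e ∧ (Summable fun i => lam i ^ 2) ∧
      HasSum (fun i => lam i • hX.chaosVar (e i)) F := by
  classical
  obtain ⟨ι, e, lam, he, hspan, heig⟩ :=
    ContinuousLinearMap.exists_orthonormal_eigenvectors (hX.isCompactOperator_chaosOperator hF)
      (hX.isSymmetric_chaosOperator F)
  have hclosed : IsClosed (wienerChaos X P 2 : Set (Lp ℝ 2 P)) :=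
    Submodule.isClosed_topologicalClosure _
  -- Elements of the chaos are centered, so pairing with `X(h)² - 1` is pairing with `X(h)²`, the
  -- quadratic form of the operator.
  have hinner : ∀ {G : Lp ℝ 2 P}, G ∈ wienerChaos X P 2 → ∀ h,
      inner ℝ G (hX.chaosVar h) = 2 * inner ℝ (hX.chaosOperator G h) h := by
    intro G hG h
    rw [inner_chaosOperator, mulLp, chaosVar, MemLp.inner_toLp_eq_integral,
      MemLp.inner_toLp_eq_integral]
    have e : ∀ ω, G ω * (X h ω ^ 2 - 1) = G ω * (X h ω * X h ω) - G ω := by intro ω; ring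
    simp_rw [e]
    rw [integral_sub ((Lp.memLp G).integrable_fun_mul (hX.memLp_mul h h (by simp)))
      ((Lp.memLp G).integrable one_le_two), hX.integral_eq_zero_of_mem_wienerChaos hG]
    ring
  -- Bessel's inequality for the orthonormal family `(X(eᵢ)² - 1) / √2`, whose coefficients in `F`
  -- are `√2 λᵢ`.
  have hsq : Summable fun i => lam i ^ 2 := by
    have := (hX.orthonormal_chaosVar he).inner_products_summable F
    refine (this.mul_left 2⁻¹).congr fun i => ?_
    rw [real_inner_smul_left, real_inner_comm, hinner hF, heig, real_inner_smul_left,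
      real_inner_self_eq_norm_sq, he.1]
    simp [mul_pow]
    ring
  obtain ⟨G, hG⟩ := hX.summable_chaosVar he hsq
  have hGmem : G ∈ wienerChaos X P 2 := hclosed.mem_of_tendsto hG
    (Eventually.of_forall fun s => Submodule.sum_mem _ fun i _ =>
      Submodule.smul_mem _ _ (hX.chaosVar_mem (he.1 i)))
  have hGeig : ∀ j, hX.chaosOperator G (e j) = lam j • e j := by
    intro j
    have h1 := (hG.mapL hX.chaosOperator).mapL (ContinuousLinearMap.apply ℝ H (e j))
    refine h1.unique ?_
    convert! hasSum_ite_eq j (lam j • e j) using 2 with i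
    rw [map_smul, hX.chaosOperator_chaosVar (he.1 i)]
    simp only [ContinuousLinearMap.apply_apply, smul_apply, ContinuousLinearMap.comp_apply,
      innerSL_apply_apply, ContinuousLinearMap.toSpanSingleton_apply, orthonormal_iff_ite.1 he]
    split_ifs with h
    · rw [h, one_smul]
    · simp
  -- The operators of `F` and `G` agree on each `eᵢ`. By symmetry the range of their difference is
  -- orthogonal to all `eᵢ`, hence zero. Then `F - G` is orthogonal to every generator while lying
  -- in the chaos, so it vanishes.
  have hzero : hX.chaosOperator (F - G) = 0 := by
    ext x
    have hx : hX.chaosOperator (F - G) x ∈ (Submodule.span ℝ (range e))ᗮ := by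
      have hle : Submodule.span ℝ (range e) ≤
          (Submodule.span ℝ {hX.chaosOperator (F - G) x})ᗮ := by
        refine Submodule.span_le.2 ?_
        rintro _ ⟨i, rfl⟩
        rw [SetLike.mem_coe, Submodule.mem_orthogonal_singleton_iff_inner_left, real_inner_comm]
        rw [show inner ℝ (hX.chaosOperator (F - G) x) (e i) =
          inner ℝ x (hX.chaosOperator (F - G) (e i)) from hX.isSymmetric_chaosOperator _ x (e i)]
        simp [heig, hGeig]
      rw [Submodule.mem_orthogonal]
      intro u hu
      exact Submodule.mem_orthogonal_singleton_iff_inner_left.1 (hle hu)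
    rw [hspan] at hx
    simpa using hx
  have hsub : F - G ∈ wienerChaos X P 2 := Submodule.sub_mem _ hF hGmem
  have horth : wienerChaos X P 2 ≤ (Submodule.span ℝ {F - G})ᗮ := by
    refine hX.wienerChaos_two_le (Submodule.isClosed_orthogonal _) fun h _ => ?_
    rw [Submodule.mem_orthogonal_singleton_iff_inner_left, real_inner_comm, hinner hsub, hzero]
    simp
  have := Submodule.mem_orthogonal_singleton_iff_inner_left.1 (horth hsub)
  rw [inner_self_eq_zero, sub_eq_zero] at this
  exact ⟨ι, e, lam, he, hsq, this ▸ hG⟩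

/-! ### Malliavin derivatives of diagonal elements of the second chaos -/

theorem coeFn_chaosVar (hX : IsIsonormal X P) (h : H) :
    hX.chaosVar h =ᵐ[P] fun ω => X h ω ^ 2 - 1 := MemLp.coeFn_toLp _

theorem exists_smoothVar_quadratic (s : Finset ι) (a : ι → ℝ) (e : ι → H) (c : ℝ) :
    ∃ (n : ℕ) (g : (Fin n → ℝ) → ℝ) (φ : Fin n → H), g.HasTemperateGrowth ∧
      (∀ ω, smoothVar X g φ ω = ∑ i ∈ s, a i * (X (e i) ω ^ 2 - 1) + c) ∧
      ∀ ω, smoothVarDeriv X g φ ω = (2 : ℝ) • ∑ i ∈ s, a i • X (e i) ω • e i := by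
  classical
  let f : Fin s.card → ι := fun k => s.equivFin.symm k
  let p : Fin s.card → (Fin s.card → ℝ) →L[ℝ] ℝ := fun k =>
    ContinuousLinearMap.proj (R := ℝ) (φ := fun _ : Fin s.card => ℝ) k
  have hsum : ∀ u : ι → ℝ, ∑ k, u (f k) = ∑ i ∈ s, u i := by
    intro u
    rw [← Finset.sum_coe_sort s, ← s.equivFin.symm.sum_comp]
  have hsum' : ∀ u : ι → H, ∑ k, u (f k) = ∑ i ∈ s, u i := by
    intro u
    rw [← Finset.sum_coe_sort s, ← s.equivFin.symm.sum_comp]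
  have d : ∀ x, HasFDerivAt (fun x => ∑ k, a (f k) * (p k x ^ 2 - 1) + c)
      (∑ k, a (f k) • ((2 * p k x) • p k)) x := by
    intro x
    refine (HasFDerivAt.fun_sum fun k _ => ?_).add_const c
    have := (((p k).hasFDerivAt (x := x)).pow 2).sub_const 1 |>.const_mul (a (f k))
    simpa using this
  refine ⟨s.card, fun x => ∑ k, a (f k) * (p k x ^ 2 - 1) + c, fun k => e (f k), ?_, ?_, ?_⟩
  · refine Function.HasTemperateGrowth.add ?_ (.const c)
    refine Function.HasTemperateGrowth.sum fun k _ => ?_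
    exact (Function.HasTemperateGrowth.const _).mul
      (((p k).hasTemperateGrowth.pow 2).sub (.const 1))
  · intro ω
    simp only [smoothVar, p, ContinuousLinearMap.proj_apply]
    rw [hsum fun i => a i * (X (e i) ω ^ 2 - 1)]
  · intro ω
    rw [← hsum' fun i => a i • X (e i) ω • e i, smoothVarDeriv, Finset.smul_sum]
    refine Finset.sum_congr rfl fun k _ => ?_
    rw [(d _).fderiv]
    simp [p, Pi.single_apply, smul_smul]
    congr 1
    ring

theorem isMalliavinDeriv_hasSum (hX : IsIsonormal X P) {a : ι → ℝ} {Q : Lp ℝ 2 P} {U : Lp H 2 P}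
    (hQ : HasSum (fun i => a i • hX.chaosVar (e i)) Q)
    (hU : HasSum (fun i => a i • hX.vecVar (e i)) U) (c : ℝ) :
    IsMalliavinDeriv X P (fun ω => Q ω + c) (((2 : ℝ) • U : Lp H 2 P) : Ω → H) := by
  refine ⟨(Lp.memLp Q).add (memLp_const c), Lp.memLp _, fun ε hε => ?_⟩
  have hU2 := hU.const_smul (2 : ℝ)
  have h1 := (EMetric.tendsto_nhds.1 hQ) ε hε
  have h2 := (EMetric.tendsto_nhds.1 hU2) ε hε
  -- One finite partial sum approximates the variable and its derivative at once; it is a quadratic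
  -- polynomial in Gaussians, hence smooth.
  obtain ⟨s, hs1, hs2⟩ := (h1.and h2).exists
  obtain ⟨n, g, φ, hg, hg1, hg2⟩ := exists_smoothVar_quadratic (X := X) s a e c
  refine ⟨n, g, φ, hg, ?_, ?_⟩
  · rw [edist_comm, Lp.edist_def] at hs1
    refine lt_of_eq_of_lt (eLpNorm_congr_ae ?_) hs1
    filter_upwards [coeFn_sum_smul s a fun i => hX.coeFn_chaosVar (e i)] with ω hω
    rw [Pi.sub_apply, Pi.sub_apply, hω, hg1]
    simp only [smul_eq_mul]
    ring
  · rw [edist_comm, Lp.edist_def] at hs2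
    refine lt_of_eq_of_lt (eLpNorm_congr_ae ?_) hs2
    rw [← Finset.smul_sum]
    filter_upwards [coeFn_sum_smul s a fun i => hX.coeFn_vecVar (e i),
      Lp.coeFn_smul (2 : ℝ) (∑ i ∈ s, a i • hX.vecVar (e i))] with ω hω h3
    rw [Pi.sub_apply, Pi.sub_apply, h3, Pi.smul_apply, hω, hg2]

/-- The inner product of two diagonal `H`-valued Gaussian vectors. -/
theorem inner_hasSum_vecVar (hX : IsIsonormal X P) (he : Orthonormal ℝ e) {a b : ι → ℝ}
    {U V : Lp H 2 P} {Q : Lp ℝ 2 P} (hU : HasSum (fun i => a i • hX.vecVar (e i)) U)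
    (hV : HasSum (fun i => b i • hX.vecVar (e i)) V) (hab : Summable fun i => a i * b i)
    (hQ : HasSum (fun i => (a i * b i) • hX.chaosVar (e i)) Q) :
    (fun ω => (inner ℝ (U ω) (V ω) : ℝ)) =ᵐ[P] fun ω => Q ω + ∑' i, a i * b i := by
  classical
  -- The pointwise inner product is continuous from `L² × L²` to `L¹`, so it may be expanded term by
  -- term; `J` is the inclusion of `L²` in `L¹`. On the diagonal `X(eᵢ)² = (X(eᵢ)² - 1) + 1`, which
  -- creates the constant.
  let B : Lp H 2 P →L[ℝ] Lp H 2 P →L[ℝ] Lp ℝ 1 P := (innerSL ℝ).holderL P 2 2 1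
  have m1 : MemLp (fun _ : Ω => (1 : ℝ)) 2 P := memLp_const 1
  let J : Lp ℝ 2 P →L[ℝ] Lp ℝ 1 P :=
    ((ContinuousLinearMap.mul ℝ ℝ).holderL P 2 2 1).flip m1.toLp
  have hB : ∀ u v : Lp H 2 P, B u v =ᵐ[P] fun ω => inner ℝ (u ω) (v ω) := fun u v =>
    (innerSL ℝ).coeFn_holder u v
  have hJ : ∀ u : Lp ℝ 2 P, J u =ᵐ[P] u := by
    intro u
    filter_upwards [(ContinuousLinearMap.mul ℝ ℝ).coeFn_holder (r := 1) u m1.toLp] with ω h1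
    refine Eq.trans h1 ?_
    simp
  have hvec : ∀ i j, B (hX.vecVar (e i)) (hX.vecVar (e j)) =
      if i = j then J (hX.chaosVar (e i)) + J m1.toLp else 0 := by
    intro i j
    refine Lp.ext ?_
    split_ifs with hij
    · subst hij
      filter_upwards [hB (hX.vecVar (e i)) (hX.vecVar (e i)), hX.coeFn_vecVar (e i),
        Lp.coeFn_add (J (hX.chaosVar (e i))) (J m1.toLp), hJ (hX.chaosVar (e i)), hJ m1.toLp,
        m1.coeFn_toLp, hX.coeFn_chaosVar (e i)] with ω h1 h2 h3 h4 h5 h6 h7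
      rw [h1, h2, h3, Pi.add_apply, h4, h5, h6, h7, real_inner_smul_left, real_inner_smul_right,
        real_inner_self_eq_norm_sq, he.1]
      ring
    · filter_upwards [hB (hX.vecVar (e i)) (hX.vecVar (e j)), hX.coeFn_vecVar (e i),
        hX.coeFn_vecVar (e j), Lp.coeFn_zero ℝ 1 P] with ω h1 h2 h3 h4
      rw [h1, h2, h3, h4, real_inner_smul_left, real_inner_smul_right, he.2 hij]
      simp
  have hUj : ∀ j, B U (hX.vecVar (e j)) = a j • (J (hX.chaosVar (e j)) + J m1.toLp) := by
    intro j
    refine ((hU.mapL B).mapL (ContinuousLinearMap.apply ℝ _ (hX.vecVar (e j)))).unique ?_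
    convert! hasSum_ite_eq j (a j • (J (hX.chaosVar (e j)) + J m1.toLp)) using 2 with i
    rw [map_smul, map_smul, ContinuousLinearMap.apply_apply, hvec]
    split_ifs with h
    · rw [h]
    · simp
  have hUV : HasSum (fun j => (a j * b j) • J (hX.chaosVar (e j)) + (a j * b j) • J m1.toLp)
      (B U V) := by
    refine (hV.mapL (B U)).congr_fun fun j => ?_
    rw [map_smul, hUj, smul_smul, smul_add, mul_comm]
  have hUV' := (hQ.mapL J).add (hab.hasSum.smul_const (J m1.toLp))
  simp only [map_smul] at hUV'
  have key := hUV.unique hUV'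
  filter_upwards [hB U V, Lp.coeFn_add (J Q) ((∑' i, a i * b i) • J m1.toLp),
    Lp.coeFn_smul (∑' i, a i * b i) (J m1.toLp), hJ Q, hJ m1.toLp, m1.coeFn_toLp]
    with ω h1 h2 h3 h4 h5 h6
  rw [← h1, key, h2, Pi.add_apply, h3, Pi.smul_apply, h4, h5, h6]
  simp

/-- The Gamma operators of a diagonal element of the second chaos. -/
theorem exists_gammaOp_ae_eq [CompleteSpace H] [TopologicalSpace.SeparableSpace H]
    (hX : IsIsonormal X P) (he : Orthonormal ℝ e) {lam : ι → ℝ}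
    (hlam : Summable fun i => lam i ^ 2) {F : Lp ℝ 2 P} (hF : F ∈ wienerChaos X P 2)
    (hFsum : HasSum (fun i => lam i • hX.chaosVar (e i)) F) (j : ℕ) :
    ∃ (Q : Lp ℝ 2 P) (c : ℝ), HasSum (fun i => (2 ^ j * lam i ^ (j + 1)) • hX.chaosVar (e i)) Q ∧
      gammaOp X P F j =ᵐ[P] fun ω => Q ω + c := by
  induction j with
  | zero => exact ⟨F, 0, by simpa using hFsum, ae_of_all _ fun ω => by simp [gammaOp]⟩
  | succ j ih =>
    obtain ⟨Q, c, hQ, hG⟩ := ih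
    have hsq : ∀ j : ℕ, Summable fun i => (2 ^ j * lam i ^ (j + 1)) ^ 2 := by
      intro j
      refine ((summable_pow_of_summable_sq hlam (n := 2 * j + 2) (by omega)).mul_left
        ((2 ^ j) ^ 2)).congr fun i => ?_
      ring
    obtain ⟨U, hU⟩ := (hX.orthonormal_vecVar he).summable_smul (hsq j)
    obtain ⟨V, hV⟩ := (hX.orthonormal_vecVar he).summable_smul
      (a := fun i => -(2⁻¹ * lam i)) (by simpa [mul_pow] using hlam.mul_left ((2 ^ 2)⁻¹))
    obtain ⟨R, hR⟩ := hX.summable_chaosVar he (hsq (j + 1))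
    have hDQ := malliavinDeriv_ae_eq hX
      (isMalliavinDeriv_congr (hX.isMalliavinDeriv_hasSum hQ hU c) hG.symm)
    have hL : HasSum (fun i => (-(2⁻¹ * lam i)) • hX.chaosVar (e i)) (pseudoInverseL X P F) := by
      rw [hX.pseudoInverseL_eq hF]
      refine (hFsum.const_smul (2⁻¹ : ℝ)).neg.congr_fun fun i => ?_
      rw [smul_smul, neg_smul]
    have hDL := malliavinDeriv_ae_eq hX
      (isMalliavinDeriv_congr (hX.isMalliavinDeriv_hasSum hL hV 0)
        (ae_of_all _ fun ω => add_zero _))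
    -- The derivatives are `2U` and `2V`, with the `-1/2` of `L⁻¹` already in `V`. Hence `⟨2U, -2V⟩
    -- = -4⟨U, V⟩`, and the factor `-1/4` turns this into the coefficients of `Γ_{j+1}`.
    have hab : ∀ i, 2 ^ j * lam i ^ (j + 1) * -(2⁻¹ * lam i) =
        -4⁻¹ * (2 ^ (j + 1) * lam i ^ (j + 1 + 1)) := by intro i; ring
    have hpair := hX.inner_hasSum_vecVar he hU hV (Q := (-4⁻¹ : ℝ) • R) ?_ ?_
    · refine ⟨R, -4 * ∑' i, 2 ^ j * lam i ^ (j + 1) * -(2⁻¹ * lam i), hR, ?_⟩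
      filter_upwards [hDQ, hDL, hpair, Lp.coeFn_smul (2 : ℝ) U, Lp.coeFn_smul (2 : ℝ) V,
        Lp.coeFn_smul (-4⁻¹ : ℝ) R] with ω h1 h2 h3 h4 h5 h6
      change inner ℝ (malliavinDeriv X P (gammaOp X P F j) ω)
        (-malliavinDeriv X P (pseudoInverseL X P F) ω) = _
      rw [h1, h2, h4, h5, Pi.smul_apply, Pi.smul_apply, inner_neg_right,
        real_inner_smul_left, real_inner_smul_right, h3, h6, Pi.smul_apply, smul_eq_mul]
      ring
    · simp_rw [hab]
      exact ((summable_pow_of_summable_sq hlam (n := j + 1 + 1) (by omega)).mul_left _).mul_left _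
    · refine (hR.const_smul (-4⁻¹ : ℝ)).congr_fun fun i => ?_
      rw [hab, smul_smul]

end IsIsonormal

/-! ### Variances and covariances of diagonal variables. -/

namespace IsIsonormal

variable {Ω : Type*} {mΩ : MeasurableSpace Ω} {P : Measure Ω} [IsProbabilityMeasure P]
  {H : Type*} [NormedAddCommGroup H] [InnerProductSpace ℝ H] {X : H → Ω → ℝ}
  {ι : Type*} {e : ι → H}

/-- `f` is, up to a constant, the diagonal second chaos variable `∑ aᵢ (X(eᵢ)² - 1)`. -/
def IsDiagonal (hX : IsIsonormal X P) (e : ι → H) (a : ι → ℝ) (f : Ω → ℝ) : Prop :=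
  ∃ (Q : Lp ℝ 2 P) (c : ℝ), HasSum (fun i => a i • hX.chaosVar (e i)) Q ∧
    f =ᵐ[P] fun ω => Q ω + c

variable {hX : IsIsonormal X P} {a b : ι → ℝ} {f g : Ω → ℝ}

theorem IsDiagonal.memLp (hf : hX.IsDiagonal e a f) : MemLp f 2 P := by
  obtain ⟨Q, c, -, h⟩ := hf
  exact (memLp_congr_ae h).2 ((Lp.memLp Q).add (memLp_const c))

theorem IsDiagonal.sub_const_mul (hf : hX.IsDiagonal e a f) (hg : hX.IsDiagonal e b g) (r : ℝ) :
    hX.IsDiagonal e (fun i => a i - r * b i) (fun ω => f ω - r * g ω) := by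
  obtain ⟨Q, c, hQ, h⟩ := hf
  obtain ⟨R, d, hR, h'⟩ := hg
  refine ⟨Q - r • R, c - r * d, ?_, ?_⟩
  · refine (hQ.sub (hR.const_smul r)).congr_fun fun i => ?_
    rw [sub_smul, smul_smul]
  · filter_upwards [h, h', Lp.coeFn_sub Q (r • R), Lp.coeFn_smul r R] with ω h1 h2 h3 h4
    rw [h1, h2, h3, Pi.sub_apply, h4, Pi.smul_apply, smul_eq_mul]
    ring

theorem IsDiagonal.hasSum_covariance (he : Orthonormal ℝ e) (hf : hX.IsDiagonal e a f)
    (hg : hX.IsDiagonal e b g) : HasSum (fun i => 2 * (a i * b i)) (cov[f, g; P]) := by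
  obtain ⟨Q, c, hQ, h⟩ := hf
  obtain ⟨R, d, hR, h'⟩ := hg
  have hclosed : IsClosed (wienerChaos X P 2 : Set (Lp ℝ 2 P)) :=
    Submodule.isClosed_topologicalClosure _
  have hmean : ∀ {a : ι → ℝ} {Q : Lp ℝ 2 P}, HasSum (fun i => a i • hX.chaosVar (e i)) Q →
      ∀ c : ℝ, ∫ ω, (Q ω + c) ∂P = c := by
    intro a Q hQ c
    have hmem : Q ∈ wienerChaos X P 2 := hclosed.mem_of_tendsto hQ
      (Eventually.of_forall fun s => Submodule.sum_mem _ fun i _ =>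
        Submodule.smul_mem _ _ (hX.chaosVar_mem (he.1 i)))
    rw [integral_add ((Lp.memLp Q).integrable one_le_two) (integrable_const c),
      hX.integral_eq_zero_of_mem_wienerChaos hmem]
    simp
  have : cov[f, g; P] = inner ℝ Q R := by
    rw [covariance, integral_congr_ae h, integral_congr_ae h', hmean hQ, hmean hR, L2.inner_def]
    refine integral_congr_ae ?_
    filter_upwards [h, h'] with ω h1 h2
    rw [h1, h2]
    simp [mul_comm]
  rw [this]
  exact hX.inner_hasSum_chaosVar he hQ hR

theorem IsDiagonal.hasSum_variance (he : Orthonormal ℝ e) (hf : hX.IsDiagonal e a f) :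
    HasSum (fun i => 2 * a i ^ 2) (variance f P) := by
  rw [← covariance_self hf.memLp.1.aemeasurable]
  simpa only [sq] using hf.hasSum_covariance he hf

section Gamma

variable [CompleteSpace H] [TopologicalSpace.SeparableSpace H] {lam : ι → ℝ} {F : Lp ℝ 2 P}

theorem isDiagonal_gammaOp (hX : IsIsonormal X P) (he : Orthonormal ℝ e)
    (hlam : Summable fun i => lam i ^ 2) (hF : F ∈ wienerChaos X P 2)
    (hFsum : HasSum (fun i => lam i • hX.chaosVar (e i)) F) (j : ℕ) :
    hX.IsDiagonal e (fun i => 2 ^ j * lam i ^ (j + 1)) (gammaOp X P F j) :=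
  hX.exists_gammaOp_ae_eq he hlam hF hFsum j

theorem isDiagonal_gammaDiff (hX : IsIsonormal X P) (he : Orthonormal ℝ e)
    (hlam : Summable fun i => lam i ^ 2) (hF : F ∈ wienerChaos X P 2)
    (hFsum : HasSum (fun i => lam i • hX.chaosVar (e i)) F) (r : ℕ) :
    hX.IsDiagonal e (fun i => 2 ^ (r + 1) * lam i ^ (r + 1) * (lam i - 1))
      (gammaDiff X P F r) := by
  have h := (hX.isDiagonal_gammaOp he hlam hF hFsum (r + 1)).sub_const_mul
    (hX.isDiagonal_gammaOp he hlam hF hFsum r) 2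
  convert! h using 1
  ext i
  ring

/-- The factored coefficient is the key formula: `Φ_F(β) = 0` exactly when every eigenvalue is a
root of `x² (x - 1) (x - β²)`. -/
theorem isDiagonal_biquadratic (hX : IsIsonormal X P) (he : Orthonormal ℝ e)
    (hlam : Summable fun i => lam i ^ 2) (hF : F ∈ wienerChaos X P 2)
    (hFsum : HasSum (fun i => lam i • hX.chaosVar (e i)) F) (β : ℝ) :
    hX.IsDiagonal e (fun i => 8 * lam i ^ 2 * (lam i - 1) * (lam i - β ^ 2))
      (fun ω => gammaDiff X P F 2 ω - 2 * β ^ 2 * gammaDiff X P F 1 ω) := by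
  have h := (hX.isDiagonal_gammaDiff he hlam hF hFsum 2).sub_const_mul
    (hX.isDiagonal_gammaDiff he hlam hF hFsum 1) (2 * β ^ 2)
  convert! h using 1
  ext i
  ring

theorem mixedMoment_eq_covariance (hX : IsIsonormal X P) (he : Orthonormal ℝ e)
    (hlam : Summable fun i => lam i ^ 2) (hF : F ∈ wienerChaos X P 2)
    (hFsum : HasSum (fun i => lam i • hX.chaosVar (e i)) F) :
    mixedMoment X P F = cov[gammaDiff X P F 2, gammaDiff X P F 1; P] := by
  have i : ∀ j, Integrable (gammaOp X P F j) P := fun j =>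
    (hX.isDiagonal_gammaOp he hlam hF hFsum j).memLp.integrable one_le_two
  have h : ∀ r, ∫ ω, gammaDiff X P F r ω ∂P =
      ∫ ω, gammaOp X P F (r + 1) ω ∂P - 2 * ∫ ω, gammaOp X P F r ω ∂P := by
    intro r
    simp only [gammaDiff]
    rw [integral_sub (i _) ((i _).const_mul 2), integral_const_mul]
  rw [covariance, mixedMoment, h, h]
  refine integral_congr_ae (ae_of_all _ fun ω => ?_)
  simp only [centeredGammaOp, gammaDiff]
  ring

end Gamma

end IsIsonormal

/-! ### Characteristic functions of the target laws. -/

section CharacteristicFunctions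

/-- The cumulant generating function `log E[exp (z (N² - 1))]` of the centered square of a
standard normal variable. -/
noncomputable def centeredChiSqCgf (z : ℂ) : ℂ :=
  -z - Complex.log (1 - 2 * z) / 2

/-- The Laplace transform `E[exp (z (N² - 1))]` of a centered square of a standard normal. -/
noncomputable def centeredChiSqTransform (z : ℂ) : ℂ :=
  Complex.exp (centeredChiSqCgf z)

theorem integral_cexp_mul_sq_sub_one_gaussianReal {z : ℂ} (hz : z.re < 1 / 2) :
    ∫ x : ℝ, Complex.exp (z * ((x : ℂ) ^ 2 - 1)) ∂(gaussianReal 0 1) =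
      centeredChiSqTransform z := by
  have hre : 0 < (1 / 2 - z).re := by
    simp only [Complex.sub_re]
    norm_num
    linarith
  have hne : (1 / 2 - z) ≠ 0 := fun h => by rw [h] at hre; exact lt_irrefl _ hre
  have hne' : 1 - 2 * z ≠ 0 := fun h => hne (by linear_combination h / 2)
  -- Keeps `1 - 2z` off the branch cut, so that the logarithm of its inverse is the negative of its
  -- logarithm.
  have harg : (1 - 2 * z).arg ≠ Real.pi := by
    intro h
    have := (Complex.arg_eq_pi_iff.1 h).1
    simp at this
    linarith
  rw [integral_gaussianReal_eq_integral_smul one_ne_zero]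
  have h1 : ∀ x : ℝ, gaussianPDFReal 0 1 x • Complex.exp (z * ((x : ℂ) ^ 2 - 1)) =
      ((√(2 * Real.pi))⁻¹ : ℝ) * Complex.exp (-z) *
        Complex.exp (-(1 / 2 - z) * (x : ℂ) ^ 2) := by
    intro x
    rw [Complex.real_smul, gaussianPDFReal]
    push_cast
    rw [mul_assoc _ _ (Complex.exp (z * _)), mul_assoc _ (Complex.exp (-z)), ← Complex.exp_add,
      ← Complex.exp_add]
    simp only [mul_one, sub_zero]
    congr 2
    ring
  simp_rw [h1]
  rw [integral_const_mul, integral_gaussian_complex hre]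
  have h2 : (Real.pi : ℂ) / (1 / 2 - z) = ((2 * Real.pi : ℝ) : ℂ) * (1 - 2 * z)⁻¹ := by
    push_cast
    have : (1 / 2 - z) = (1 - 2 * z) / 2 := by ring
    rw [this]
    field_simp
  have hpi : (0 : ℝ) < 2 * Real.pi := by positivity
  have h3 : ((√(2 * Real.pi))⁻¹ : ℝ) = Real.exp (-(Real.log (2 * Real.pi) / 2)) := by
    rw [Real.exp_neg, Real.exp_half, Real.exp_log hpi]
  rw [h2, Complex.cpow_def_of_ne_zero
    (mul_ne_zero (Complex.ofReal_ne_zero.2 hpi.ne') (inv_ne_zero hne')),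
    Complex.log_ofReal_mul hpi (inv_ne_zero hne'), Complex.log_inv _ harg, h3, Complex.ofReal_exp,
    ← Complex.exp_add, ← Complex.exp_add, centeredChiSqTransform, centeredChiSqCgf]
  congr 1
  push_cast
  ring

theorem charFun_map_mul_sq_sub_one_gaussianReal (c t : ℝ) :
    charFun ((gaussianReal 0 1).map fun x => c * (x ^ 2 - 1)) t =
      centeredChiSqTransform (Complex.I * t * c) := by
  rw [charFun_apply_real, integral_map (by fun_prop) (by fun_prop),
    ← integral_cexp_mul_sq_sub_one_gaussianReal (by simp)]
  congr 1
  ext x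
  push_cast
  ring_nf

theorem integral_gammaMeasure {E : Type*} [NormedAddCommGroup E] [NormedSpace ℝ E] {a r : ℝ}
    (ha : 0 < a) (hr : 0 < r) (f : ℝ → E) :
    ∫ x, f x ∂(gammaMeasure a r) =
      ∫ x in Ioi 0, (r ^ a / Real.Gamma a * x ^ (a - 1) * Real.exp (-(r * x))) • f x := by
  have hm : Measurable (gammaPDF a r) := (measurable_gammaPDFReal a r).ennreal_ofReal
  rw [gammaMeasure, integral_withDensity_eq_integral_toReal_smul
    hm
    (ae_of_all _ fun _ => ENNReal.ofReal_lt_top)]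
  rw [← integral_Ici_eq_integral_Ioi, ← integral_indicator measurableSet_Ici]
  congr 1
  ext x
  by_cases hx : 0 ≤ x
  · rw [indicator_of_mem (by exact hx), gammaPDF_of_nonneg hx, ENNReal.toReal_ofReal]
    have := Real.Gamma_pos_of_pos ha
    positivity
  · rw [indicator_of_notMem (by exact hx), gammaPDF_of_neg (not_le.1 hx)]
    simp

theorem mgf_gammaMeasure {a r : ℝ} (ha : 0 < a) (hr : 0 < r) {s : ℝ} (hs : s < r) :
    mgf id (gammaMeasure a r) s = (1 - s / r) ^ (-a) := by
  have hG := Real.Gamma_pos_of_pos ha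
  rw [mgf, integral_gammaMeasure ha hr]
  have h1 : ∀ x : ℝ, (r ^ a / Real.Gamma a * x ^ (a - 1) * Real.exp (-(r * x))) •
      Real.exp (s * id x) =
      (r ^ a / Real.Gamma a) * (x ^ (a - 1) * Real.exp (-((r - s) * x))) := by
    intro x
    rw [smul_eq_mul, mul_assoc, mul_assoc, ← Real.exp_add]
    simp only [id]
    congr 3
    ring
  simp_rw [h1]
  rw [integral_const_mul, Real.integral_rpow_mul_exp_neg_mul_Ioi ha (sub_pos.2 hs)]
  have h2 : 1 - s / r = (r - s) / r := by field_simp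
  have h3 := sub_pos.2 hs
  rw [h2, Real.rpow_neg (by positivity), Real.div_rpow h3.le hr.le, Real.div_rpow zero_le_one h3.le,
    Real.one_rpow]
  have := Real.rpow_pos_of_pos h3 a
  have := Real.rpow_pos_of_pos hr a
  field_simp

/-- Analytic continuation: both sides extend to analytic functions on the half-plane `Re z < r` and
agree at real points near 0 by the formula for the moment generating function. The identity theorem
carries this to the imaginary axis. -/
theorem charFun_gammaMeasure {a r : ℝ} (ha : 0 < a) (hr : 0 < r) (t : ℝ) :
    charFun (gammaMeasure a r) t =
      Complex.exp (-(a * Complex.log (1 - Complex.I * t / r))) := by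
  have := isProbabilityMeasure_gammaMeasure ha hr
  have hset : Iio r ⊆ interior (integrableExpSet id (gammaMeasure a r)) := by
    refine interior_maximal ?_ isOpen_Iio
    intro s hs
    have h := mgf_gammaMeasure ha hr hs
    rw [integrableExpSet, mem_ofPred_eq, ← mgf_pos_iff, h]
    have : 0 < 1 - s / r := by
      rw [sub_pos, div_lt_one hr]
      exact hs
    positivity
  set U : Set ℂ := {z | z.re < r} with hU
  have hslit : ∀ z ∈ U, 1 - z / r ∈ Complex.slitPlane := by
    intro z hz
    left
    simp only [Complex.sub_re, Complex.one_re, Complex.div_ofReal_re]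
    rw [sub_pos, div_lt_one hr]
    exact hz
  have h1 : AnalyticOnNhd ℂ (complexMGF id (gammaMeasure a r)) U :=
    analyticOnNhd_complexMGF.mono fun z hz => hset hz
  have hopen : IsOpen U := isOpen_lt Complex.continuous_re continuous_const
  have h2 : AnalyticOnNhd ℂ (fun z : ℂ => Complex.exp (-(a * Complex.log (1 - z / r)))) U := by
    refine DifferentiableOn.analyticOnNhd (fun z hz => ?_) hopen
    have := hslit z hz
    have hd : DifferentiableAt ℂ (fun z : ℂ => 1 - z / r) z := by fun_prop
    exact ((hd.clog this).const_mul (a : ℂ)).neg.cexp.differentiableWithinAt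
  have hreal : ∀ s : ℝ, s < r → complexMGF id (gammaMeasure a r) s =
      Complex.exp (-(a * Complex.log (1 - s / r))) := by
    intro s hs
    have h0 : 0 < 1 - s / r := by
      rw [sub_pos, div_lt_one hr]
      exact hs
    rw [complexMGF_ofReal, mgf_gammaMeasure ha hr hs, Real.rpow_def_of_pos h0]
    push_cast
    rw [Complex.ofReal_log h0.le]
    push_cast
    ring_nf
  have hfreq : ∃ᶠ z in 𝓝[≠] (0 : ℂ), complexMGF id (gammaMeasure a r) z =
      Complex.exp (-(a * Complex.log (1 - z / r))) := by
    have h4 : ∃ᶠ s : ℝ in 𝓝[≠] (0 : ℝ), s < r :=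
      (eventually_nhdsWithin_of_eventually_nhds (eventually_lt_nhds hr)).frequently
    have ht : Tendsto (fun s : ℝ => (s : ℂ)) (𝓝[≠] 0) (𝓝[≠] 0) := by
      refine tendsto_nhdsWithin_iff.2 ⟨?_, ?_⟩
      · exact (Complex.continuous_ofReal.tendsto' 0 0 (by simp)).mono_left nhdsWithin_le_nhds
      · filter_upwards [self_mem_nhdsWithin] with s hs
        simpa using hs
    exact ht.frequently (h4.mono fun s hs => hreal s hs)
  have hconv : IsPreconnected U := by
    have : Convex ℝ U := convex_halfSpace_re_lt r
    exact this.isPreconnected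
  have h := h1.eqOn_of_preconnected_of_frequently_eq h2 hconv (z₀ := 0) (by simpa [hU] using hr)
    hfreq (show (t * Complex.I : ℂ) ∈ U by simpa [hU] using hr)
  rw [complexMGF_id_mul_I] at h
  rw [h]
  ring_nf

theorem charFun_map_two_mul_sub_gammaMeasure {a r : ℝ} (ha : 0 < a) (hr : 0 < r) (c t : ℝ) :
    charFun ((gammaMeasure a r).map fun x => 2 * x - c) t =
      Complex.exp (-(Complex.I * t * c) - a * Complex.log (1 - 2 * (Complex.I * t / r))) := by
  have h : (fun x : ℝ => 2 * x - c) = (fun x => x + -c) ∘ fun x => 2 * x := by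
    ext x
    simp [sub_eq_add_neg]
  rw [h, ← Measure.map_map (by fun_prop) (by fun_prop), charFun_map_add_const, charFun_map_mul,
    charFun_gammaMeasure ha hr, ← Complex.exp_add]
  congr 1
  simp
  ring_nf

theorem charFun_centeredGammaLaw {ν : ℝ} (hν : 0 < ν) (t : ℝ) :
    charFun (centeredGammaLaw ν) t = Complex.exp (ν * centeredChiSqCgf (Complex.I * t)) := by
  rw [centeredChiSqCgf, centeredGammaLaw, charFun_map_two_mul_sub_gammaMeasure (by positivity) one_pos]
  congr 1
  push_cast
  ring_nf

theorem charFun_scaledGammaLaw {ℓ : ℕ} {k : ℝ} (hk : ℓ = 0 ∨ 0 < k) (t : ℝ) :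
    charFun (scaledGammaLaw ℓ k) t =
      centeredChiSqTransform (Complex.I * t * (k / 2 : ℝ)) ^ ℓ := by
  rw [scaledGammaLaw]
  split_ifs with h
  · simp [h, charFun_dirac]
  have hk := hk.resolve_left h
  have hl : (0 : ℝ) < ℓ := by exact_mod_cast Nat.pos_of_ne_zero h
  rw [charFun_map_two_mul_sub_gammaMeasure (by positivity) (by positivity), centeredChiSqTransform,
    ← Complex.exp_nat_mul, centeredChiSqCgf]
  congr 1
  push_cast
  have : (k : ℂ) ≠ 0 := by exact_mod_cast hk.ne'
  have e : Complex.I * t / (2 / k) = Complex.I * t * (k / 2) := by field_simp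
  rw [e]
  ring

theorem charFun_mixedChiSqLaw (ℓ₁ ℓ₂ : ℕ) (k t : ℝ) :
    charFun (mixedChiSqLaw ℓ₁ ℓ₂ k) t =
      centeredChiSqTransform (Complex.I * t * (k / 2 : ℝ)) ^ ℓ₁ *
        centeredChiSqTransform (Complex.I * t) ^ ℓ₂ := by
  rw [mixedChiSqLaw, charFun_apply_real, integral_map (by fun_prop) (by fun_prop)]
  set w : Fin ℓ₁ ⊕ Fin ℓ₂ → ℂ :=
    Sum.elim (fun _ => Complex.I * t * (k / 2 : ℝ)) (fun _ => Complex.I * t) with hw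
  have h : ∀ x : Fin ℓ₁ ⊕ Fin ℓ₂ → ℝ, Complex.exp (t * (((∑ i, k / 2 * (x (Sum.inl i) ^ 2 - 1)) +
      (∑ j, (x (Sum.inr j) ^ 2 - 1)) : ℝ) : ℂ) * Complex.I) =
      ∏ i, Complex.exp (w i * ((x i : ℂ) ^ 2 - 1)) := by
    intro x
    rw [← Complex.exp_sum, Fintype.sum_sum_type]
    congr 1
    simp only [hw, Sum.elim_inl, Sum.elim_inr]
    push_cast
    rw [mul_add, add_mul, Finset.mul_sum, Finset.sum_mul, Finset.mul_sum, Finset.sum_mul]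
    congr 1 <;> refine Finset.sum_congr rfl fun i _ => by ring
  simp_rw [h]
  rw [integral_fintype_prod_eq_prod (f := fun i (x : ℝ) => Complex.exp (w i * ((x : ℂ) ^ 2 - 1)))]
  have h2 : ∀ i, ∫ x : ℝ, Complex.exp (w i * ((x : ℂ) ^ 2 - 1)) ∂(gaussianReal 0 1) =
      centeredChiSqTransform (w i) := by
    intro i
    refine integral_cexp_mul_sq_sub_one_gaussianReal ?_
    cases i <;> simp [hw]
  simp_rw [h2]
  rw [Fintype.prod_sum_type]
  simp [hw]

end CharacteristicFunctions

/-! ### Characteristic function of a diagonal variable. -/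

section CharFunLimits

variable {Ω : Type*} {mΩ : MeasurableSpace Ω} {P : Measure Ω}

namespace IsIsonormal

variable {H : Type*} [NormedAddCommGroup H] [InnerProductSpace ℝ H] {X : H → Ω → ℝ}
  {ι : Type*} {e : ι → H}

theorem charFun_map_mul_sq_sub_one (hX : IsIsonormal X P) {h : H} (hh : ‖h‖ = 1) (c t : ℝ) :
    charFun (P.map fun ω => c * (X h ω ^ 2 - 1)) t =
      centeredChiSqTransform (Complex.I * t * c) := by
  have hn : ‖h‖₊ = 1 := NNReal.eq hh
  have hm : P.map (X h) = gaussianReal 0 1 := by rw [hX.map_eq h, hn, one_pow]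
  rw [← charFun_map_mul_sq_sub_one_gaussianReal, ← hm,
    AEMeasurable.map_map_of_aemeasurable (by fun_prop)
      (hX.memLp h ENNReal.ofNat_ne_top : MemLp _ 2 P).1.aemeasurable]
  rfl

theorem iIndepFun_of_orthonormal (hX : IsIsonormal X P) {κ : Type*} [Fintype κ] {ψ : κ → H}
    (hψ : Orthonormal ℝ ψ) : iIndepFun (fun k => X (ψ k)) P :=
  (hX.hasGaussianLaw_pi ψ).iIndepFun_of_covariance_eq_zero fun i j hij => by
    rw [hX.covariance_apply, hψ.2 hij]

end IsIsonormal

variable [IsProbabilityMeasure P]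

/-- Since `|e^{ix} - e^{iy}| ≤ |x - y|`, characteristic functions are Lipschitz in the `L¹`
distance, which the `L²` distance dominates. -/
theorem norm_charFun_map_sub_le (f g : Lp ℝ 2 P) (t : ℝ) :
    ‖charFun (P.map f) t - charFun (P.map g) t‖ ≤ |t| * ‖f - g‖ := by
  have hint : ∀ h : Lp ℝ 2 P,
      Integrable (fun ω => Complex.exp (t * (h ω : ℝ) * Complex.I)) P := by
    intro h
    refine Integrable.of_bound (C := 1) ?_ (ae_of_all _ fun ω => ?_)
    · have := (Lp.memLp h).1
      fun_prop
    · rw [← Complex.ofReal_mul, Complex.norm_exp_ofReal_mul_I]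
  have hmeas : ∀ h : Lp ℝ 2 P, AEMeasurable h P := fun h => (Lp.memLp h).1.aemeasurable
  rw [charFun_apply_real, charFun_apply_real, integral_map (hmeas f) (by fun_prop),
    integral_map (hmeas g) (by fun_prop), ← integral_sub (hint f) (hint g)]
  have hL1 : ∫ ω, ‖(f - g : Lp ℝ 2 P) ω‖ ∂P ≤ ‖f - g‖ := by
    have hm := Lp.memLp (f - g)
    rw [integral_norm_eq_lintegral_enorm hm.1, ← eLpNorm_one_eq_lintegral_enorm, Lp.norm_def]
    exact ENNReal.toReal_mono hm.2.ne (eLpNorm_le_eLpNorm_of_exponent_le one_le_two hm.1)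
  refine le_trans ?_ (mul_le_mul_of_nonneg_left hL1 (abs_nonneg t))
  rw [← integral_const_mul]
  refine norm_integral_le_of_norm_le
    (((Lp.memLp (f - g)).integrable one_le_two).norm.const_mul _) ?_
  filter_upwards [Lp.coeFn_sub f g] with ω hω
  rw [hω, Pi.sub_apply]
  have h1 : Complex.exp (t * (f ω : ℝ) * Complex.I) - Complex.exp (t * (g ω : ℝ) * Complex.I) =
      Complex.exp ((t * g ω : ℝ) * Complex.I) *
        (Complex.exp (Complex.I * (t * (f ω - g ω) : ℝ)) - 1) := by
    rw [mul_sub, ← Complex.exp_add, mul_one]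
    congr 2 <;> push_cast <;> ring
  rw [h1, norm_mul, Complex.norm_exp_ofReal_mul_I, one_mul]
  refine Real.norm_exp_I_mul_ofReal_sub_one_le.trans (le_of_eq ?_)
  rw [norm_mul, Real.norm_eq_abs t]

theorem tendsto_charFun_map {κ : Type*} {l : Filter κ} {u : κ → Lp ℝ 2 P} {f : Lp ℝ 2 P}
    (h : Tendsto u l (𝓝 f)) (t : ℝ) :
    Tendsto (fun k => charFun (P.map (u k)) t) l (𝓝 (charFun (P.map f) t)) := by
  rw [tendsto_iff_norm_sub_tendsto_zero] at h ⊢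
  refine squeeze_zero (fun _ => norm_nonneg _) (fun k => norm_charFun_map_sub_le _ _ t) ?_
  simpa using h.const_mul |t|

namespace IsIsonormal

variable {H : Type*} [NormedAddCommGroup H] [InnerProductSpace ℝ H] {X : H → Ω → ℝ}
  {ι : Type*} {e : ι → H}

theorem charFun_map_finsetSum_chaosVar (hX : IsIsonormal X P) (he : Orthonormal ℝ e)
    (s : Finset ι) (a : ι → ℝ) (t : ℝ) :
    charFun (P.map (∑ i ∈ s, a i • hX.chaosVar (e i) : Lp ℝ 2 P)) t =
      ∏ i ∈ s, centeredChiSqTransform (Complex.I * t * a i) := by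
  have hm : ∀ h, AEMeasurable (X h) P := fun h =>
    (hX.memLp h ENNReal.ofNat_ne_top : MemLp _ 2 P).1.aemeasurable
  have hmeas : ∀ i, AEMeasurable (fun ω => a i * (X (e i) ω ^ 2 - 1)) P := fun i => by
    have := hm (e i)
    fun_prop
  have hind : iIndepFun (s.restrict fun i ω => a i * (X (e i) ω ^ 2 - 1)) P := by
    have h1 : Orthonormal ℝ fun i : s => e i := he.comp _ Subtype.val_injective
    exact (hX.iIndepFun_of_orthonormal h1).comp (fun i x => a i * (x ^ 2 - 1))
      fun i => by fun_prop
  rw [Measure.map_congr (coeFn_sum_smul s a fun i => hX.coeFn_chaosVar (e i))]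
  simp only [smul_eq_mul]
  rw [hind.charFun_map_fun_finsetSum_eq_prod fun i _ => hmeas i, Finset.prod_apply]
  exact Finset.prod_congr rfl fun i _ => hX.charFun_map_mul_sq_sub_one (he.1 i) _ _

/-- Finite sums have independent summands, so their characteristic functions are products. Using a
sum of exponents avoids infinite products; its convergence is left to the caller, who has either
small `t` or an explicit spectrum. -/
theorem charFun_map_eq_exp (hX : IsIsonormal X P) (he : Orthonormal ℝ e) {a : ι → ℝ}
    {F : Lp ℝ 2 P} (hF : HasSum (fun i => a i • hX.chaosVar (e i)) F) {t : ℝ} {S : ℂ}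
    (hS : HasSum (fun i => centeredChiSqCgf (Complex.I * t * a i)) S) :
    charFun (P.map F) t = Complex.exp S := by
  refine tendsto_nhds_unique (tendsto_charFun_map hF t)
    (((Complex.continuous_exp.tendsto S).comp hS).congr fun s => ?_)
  rw [hX.charFun_map_finsetSum_chaosVar he, Function.comp_apply, Complex.exp_sum]
  rfl

end IsIsonormal

end CharFunLimits

/-! ### Cumulants as power sums of the eigenvalues. -/

section Cumulants

theorem hasSum_centeredChiSqCgf {z : ℂ} (hz : ‖2 * z‖ < 1) :
    HasSum (fun n : ℕ => (2 * z) ^ (n + 2) / (2 * (n + 2))) (centeredChiSqCgf z) := by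
  have h := (hasSum_nat_add_iff' 2).2 (Complex.hasSum_taylorSeries_neg_log hz)
  convert! h.div_const 2 using 1
  · ext n
    push_cast
    field_simp
  · simp [Finset.sum_range_succ, centeredChiSqCgf]
    ring

theorem exists_hasSum_centeredChiSqCgf {ι : Type*} {a : ι → ℝ} (ha : Summable fun i => a i ^ 2) :
    ∀ᶠ t : ℝ in 𝓝 0, ∃ S : ℂ, HasSum (fun i => centeredChiSqCgf (Complex.I * t * a i)) S ∧
      HasSum (fun n : ℕ => (2 * (Complex.I * t)) ^ (n + 2) / (2 * (n + 2)) *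
        ((∑' i, a i ^ (n + 2) : ℝ) : ℂ)) S := by
  obtain ⟨R, hR0, hle⟩ : ∃ R, 0 ≤ R ∧ ∀ i, |a i| ≤ R :=
    ⟨√(∑' i, a i ^ 2), Real.sqrt_nonneg _,
      fun i => Real.abs_le_sqrt (ha.le_tsum i fun j _ => sq_nonneg _)⟩
  have hev : ∀ᶠ t : ℝ in 𝓝 0, |2 * t| * R < 1 := by
    have : Tendsto (fun t : ℝ => |2 * t| * R) (𝓝 0) (𝓝 0) := by
      have : Continuous fun t : ℝ => |2 * t| * R := by fun_prop
      simpa using this.tendsto 0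
    exact this.eventually (gt_mem_nhds one_pos)
  filter_upwards [hev] with t ht
  obtain ⟨r, hr⟩ : ∃ r, |2 * t| * R = r := ⟨_, rfl⟩
  rw [hr] at ht
  have hr0 : 0 ≤ r := by rw [← hr]; positivity
  have hnorm : ∀ i, ‖2 * (Complex.I * t * a i)‖ = |2 * t| * |a i| := by
    intro i
    simp [abs_mul, mul_assoc]
  have hnorm_le : ∀ i, ‖2 * (Complex.I * t * a i)‖ ≤ r := by
    intro i
    rw [hnorm, ← hr]
    exact mul_le_mul_of_nonneg_left (hle i) (abs_nonneg _)
  obtain ⟨f, hf⟩ : ∃ f : ι × ℕ → ℂ, ∀ x, f x =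
    (2 * (Complex.I * t * a x.1)) ^ (x.2 + 2) / (2 * (x.2 + 2)) := ⟨_, fun _ => rfl⟩
  -- Absolute summability over both indices, dominated by `(2t)² aᵢ² rⁿ` with `r < 1`, justifies
  -- exchanging the sum over eigenvalues with the Taylor series.
  have hsum : Summable f := by
    have hg := ((ha.mul_left ((2 * t) ^ 2)).mul_of_nonneg (summable_geometric_of_lt_one hr0 ht)
      (fun i => by positivity) (fun n => by positivity))
    refine Summable.of_norm_bounded hg fun x => ?_
    rw [hf, norm_div, norm_pow]
    have hden : 1 ≤ ‖(2 * ((x.2 : ℂ) + 2))‖ := by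
      have : (2 * ((x.2 : ℂ) + 2)) = ((2 * (x.2 + 2) : ℕ) : ℂ) := by push_cast; ring
      rw [this, Complex.norm_natCast]
      exact_mod_cast (by omega : 1 ≤ 2 * (x.2 + 2))
    refine (div_le_self (by positivity) hden).trans ?_
    rw [pow_add, mul_comm]
    refine mul_le_mul (le_of_eq ?_) (pow_le_pow_left₀ (norm_nonneg _) (hnorm_le _) _)
      (by positivity) (by positivity)
    rw [hnorm, mul_pow, sq_abs, sq_abs]
  obtain ⟨S, hS⟩ := hsum
  refine ⟨S, hS.prod_fiberwise fun i => ?_, ?_⟩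
  · simp only [hf]
    exact hasSum_centeredChiSqCgf ((hnorm_le i).trans_lt ht)
  have hS' := (Equiv.prodComm ℕ ι).hasSum_iff.2 hS
  refine hS'.prod_fiberwise fun n => ?_
  have hp : HasSum (fun i => a i ^ (n + 2)) (∑' i, a i ^ (n + 2)) :=
    (summable_pow_of_summable_sq ha (by omega)).hasSum
  refine ((Complex.hasSum_ofReal.2 hp).mul_left
    ((2 * (Complex.I * t)) ^ (n + 2) / (2 * (n + 2)))).congr_fun fun i => ?_
  simp only [hf, Function.comp_apply, Equiv.prodComm_apply, Prod.swap, Complex.ofReal_pow]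
  ring

theorem iteratedDeriv_zero_of_hasSum {f : ℝ → ℂ} {c : ℕ → ℂ}
    (h : ∀ᶠ t : ℝ in 𝓝 0, HasSum (fun n => (t : ℂ) ^ n * c n) (f t)) (n : ℕ) :
    iteratedDeriv n f 0 = n.factorial * c n := by
  let p : FormalMultilinearSeries ℝ ℝ ℂ := fun n =>
    ContinuousMultilinearMap.mkPiRing ℝ (Fin n) (c n)
  have hp : ∀ n, p.coeff n = c n := fun n => by
    simp [p, FormalMultilinearSeries.coeff]
  have hf : HasFPowerSeriesAt f p 0 := by
    rw [hasFPowerSeriesAt_iff]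
    filter_upwards [h] with t ht
    rw [zero_add]
    refine ht.congr_fun fun n => ?_
    rw [hp, Complex.real_smul, Complex.ofReal_pow]
  obtain ⟨r, hr⟩ := hf
  have := hr.factorial_smul 1 n
  rw [iteratedFDeriv_apply_eq_iteratedDeriv_mul_prod, Finset.prod_const_one, one_smul] at this
  rw [← this]
  simp [p]

theorem continuousAt_of_hasSum {f : ℝ → ℂ} {c : ℕ → ℂ}
    (h : ∀ᶠ t : ℝ in 𝓝 0, HasSum (fun n => (t : ℂ) ^ n * c n) (f t)) : ContinuousAt f 0 := by
  let p : FormalMultilinearSeries ℝ ℝ ℂ := fun n =>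
    ContinuousMultilinearMap.mkPiRing ℝ (Fin n) (c n)
  have hf : HasFPowerSeriesAt f p 0 := by
    rw [hasFPowerSeriesAt_iff]
    filter_upwards [h] with t ht
    rw [zero_add]
    refine ht.congr_fun fun n => ?_
    simp [p, FormalMultilinearSeries.coeff]
  exact hf.continuousAt

variable {Ω : Type*} {mΩ : MeasurableSpace Ω} {P : Measure Ω} {Y : Ω → ℝ}

theorem cumulant_of_charFun_eq_exp {q : ℕ → ℝ}
    (h : ∀ᶠ t : ℝ in 𝓝 0, ∃ S : ℂ, charFun (P.map Y) t = Complex.exp S ∧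
      HasSum (fun n : ℕ => (2 * (Complex.I * t)) ^ (n + 2) / (2 * (n + 2)) * (q (n + 2) : ℂ)) S)
    {n : ℕ} (hn : 2 ≤ n) : cumulant P Y n = 2 ^ (n - 1) * (n - 1).factorial * q n := by
  classical
  let c : ℕ → ℂ := fun n => if n < 2 then 0 else (2 * Complex.I) ^ n / (2 * n) * (q n : ℂ)
  let S : ℝ → ℂ := fun t => ∑' n, (t : ℂ) ^ n * c n
  have hS : ∀ᶠ t : ℝ in 𝓝 0, HasSum (fun n => (t : ℂ) ^ n * c n) (S t) ∧
      charFun (P.map Y) t = Complex.exp (S t) := by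
    filter_upwards [h] with t ht
    obtain ⟨T, hT, hT'⟩ := ht
    have h1 : HasSum (fun n => (t : ℂ) ^ n * c n) T := by
      rw [← hasSum_nat_add_iff' 2]
      have : T - ∑ i ∈ Finset.range 2, (t : ℂ) ^ i * c i = T := by
        simp [Finset.sum_range_succ, c]
      rw [this]
      refine hT'.congr_fun fun n => ?_
      simp only [c, if_neg (by omega : ¬ n + 2 < 2)]
      push_cast
      rw [← mul_assoc 2, mul_pow (2 * Complex.I)]
      ring
    have h2 : S t = T := h1.tsum_eq
    rw [h2]
    exact ⟨h1, hT⟩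
  have hS0 : S 0 = 0 := by
    simp only [S]
    rw [tsum_eq_single 0]
    · simp [c]
    · intro n hn
      simp [hn]
  have hcont : ContinuousAt S 0 := continuousAt_of_hasSum (hS.mono fun t ht => ht.1)
  have him : ∀ᶠ t in 𝓝 (0 : ℝ), |(S t).im| < Real.pi := by
    have : Tendsto (fun t => |(S t).im|) (𝓝 0) (𝓝 0) := by
      have := (Complex.continuous_im.continuousAt.comp hcont).abs.tendsto
      simpa [hS0] using this
    exact this.eventually (gt_mem_nhds Real.pi_pos)
  have hlog : ∀ᶠ t : ℝ in 𝓝 0,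
      HasSum (fun n => (t : ℂ) ^ n * c n) (Complex.log (charFun (P.map Y) t)) := by
    filter_upwards [hS, him] with t ht hi
    rw [abs_lt] at hi
    rw [ht.2, Complex.log_exp hi.1 hi.2.le]
    exact ht.1
  rw [cumulant, iteratedDeriv_zero_of_hasSum hlog]
  simp only [c, if_neg (by omega : ¬ n < 2)]
  obtain ⟨m, rfl⟩ : ∃ m, n = m + 1 := ⟨n - 1, by omega⟩
  have e : (((m + 1).factorial : ℂ) * ((2 * Complex.I) ^ (m + 1) / (2 * ((m + 1 : ℕ) : ℂ)) *
      (q (m + 1) : ℂ))) / Complex.I ^ (m + 1) =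
      ((2 ^ m * m.factorial * q (m + 1) : ℝ) : ℂ) := by
    have hI : Complex.I ^ (m + 1) ≠ 0 := pow_ne_zero _ Complex.I_ne_zero
    have hm : (m : ℂ) + 1 ≠ 0 := by exact_mod_cast Nat.succ_ne_zero m
    rw [Nat.factorial_succ, mul_pow]
    push_cast
    field_simp
    ring
  rw [e, Complex.ofReal_re]
  rfl

theorem cumulant_of_map_eq_centeredGammaLaw {ν : ℝ} (hν : 0 < ν)
    (h : P.map Y = centeredGammaLaw ν) {n : ℕ} (hn : 2 ≤ n) :
    cumulant P Y n = 2 ^ (n - 1) * (n - 1).factorial * ν := by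
  refine cumulant_of_charFun_eq_exp (q := fun _ => ν) ?_ hn
  have hev : ∀ᶠ t : ℝ in 𝓝 0, |2 * t| < 1 := by
    have : Continuous fun t : ℝ => |2 * t| := by fun_prop
    have := this.tendsto 0
    simp only [mul_zero, abs_zero] at this
    exact this.eventually (gt_mem_nhds one_pos)
  filter_upwards [hev] with t ht
  refine ⟨_, by rw [h, charFun_centeredGammaLaw hν], ?_⟩
  rw [mul_comm (ν : ℂ)]
  exact (hasSum_centeredChiSqCgf (by simpa [abs_mul] using ht)).mul_right _

theorem IsIsonormal.cumulant_eq [IsProbabilityMeasure P] {H : Type*} [NormedAddCommGroup H]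
    [InnerProductSpace ℝ H] {X : H → Ω → ℝ} {ι : Type*} {e : ι → H} (hX : IsIsonormal X P)
    (he : Orthonormal ℝ e) {a : ι → ℝ} (ha : Summable fun i => a i ^ 2) {F : Lp ℝ 2 P}
    (hF : HasSum (fun i => a i • hX.chaosVar (e i)) F) {n : ℕ} (hn : 2 ≤ n) :
    cumulant P F n = 2 ^ (n - 1) * (n - 1).factorial * ∑' i, a i ^ n := by
  refine cumulant_of_charFun_eq_exp (q := fun n => ∑' i, a i ^ n) ?_ hn
  filter_upwards [exists_hasSum_centeredChiSqCgf ha] with t ht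
  obtain ⟨S, hS, hS'⟩ := ht
  exact ⟨S, hX.charFun_map_eq_exp he hF hS, hS'⟩

end Cumulants

/-! ### The biquadratic polynomial in `β`. -/

section BiquadraticPolynomial

variable {W M V : ℝ} {φ : ℝ → ℝ}

/-- Completion of the square in `β²`. When `V = 0` the quotient `M / (2 * V)` is 0 by convention,
and `hVM` removes the `β²` term. -/
theorem biquadratic_eq (hφ : ∀ β, φ β = W - 4 * β ^ 2 * M + 4 * β ^ 4 * V) (hM : 0 ≤ M)
    (hV : 0 ≤ V) (hVM : V = 0 → M = 0) (β : ℝ) :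
    φ β = φ √(M / (2 * V)) + 4 * V * (β ^ 2 - M / (2 * V)) ^ 2 := by
  have h2 : √(M / (2 * V)) ^ 2 = M / (2 * V) := Real.sq_sqrt (by positivity)
  have h4 : √(M / (2 * V)) ^ 4 = (M / (2 * V)) ^ 2 := by
    rw [show √(M / (2 * V)) ^ 4 = (√(M / (2 * V)) ^ 2) ^ 2 by ring, h2]
  rw [hφ, hφ √_, h2, h4]
  rcases eq_or_ne V 0 with h | h
  · simp [h, hVM h]
  · field_simp
    ring

theorem biquadratic_neg (hφ : ∀ β, φ β = W - 4 * β ^ 2 * M + 4 * β ^ 4 * V) (β : ℝ) :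
    φ (-β) = φ β := by
  rw [hφ, hφ]
  ring

theorem biquadratic_isLocalMax_zero (hφ : ∀ β, φ β = W - 4 * β ^ 2 * M + 4 * β ^ 4 * V)
    (hM : 0 ≤ M) (h : 0 < M ∨ V = 0) : IsLocalMax φ 0 := by
  have hle : ∀ᶠ β : ℝ in 𝓝 0, β ^ 2 * V ≤ M := by
    rcases h with h | h
    · have : Tendsto (fun β : ℝ => β ^ 2 * V) (𝓝 0) (𝓝 0) := by
        have : Continuous fun β : ℝ => β ^ 2 * V := by fun_prop
        simpa using this.tendsto 0
      exact (this.eventually (gt_mem_nhds h)).mono fun _ => le_of_lt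
    · exact Eventually.of_forall fun β => by rw [h, mul_zero]; exact hM
  filter_upwards [hle] with β hβ
  rw [hφ, hφ 0]
  nlinarith [mul_le_mul_of_nonneg_left hβ (sq_nonneg β)]

end BiquadraticPolynomial

/-! ### Eigenvalue families with few values. -/

section Spectrum

variable {ι : Type*} {a : ι → ℝ}

theorem eq_zero_of_hasSum_sq {b : ι → ℝ} {c : ℝ} (hc : 0 < c)
    (h : HasSum (fun i => c * b i ^ 2) 0) (i : ι) : b i = 0 := by
  have := (hasSum_zero_iff_of_nonneg fun i => by positivity).1 h
  have := congrFun this i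
  simpa [hc.ne'] using this

/-- Each nonnegative term is at most the whole sum `S`, so `bᵢ² ≤ S bᵢ`. -/
theorem hasSum_sq_le_sq {b : ι → ℝ} {S T : ℝ} (hb : ∀ i, 0 ≤ b i) (hS : HasSum b S)
    (hT : HasSum (fun i => b i ^ 2) T) : T ≤ S ^ 2 := by
  rw [sq]
  refine hasSum_le (fun i => ?_) hT (hS.mul_left S)
  rw [sq]
  exact mul_le_mul_of_nonneg_right (le_hasSum hS i fun j _ => hb j) (hb i)

theorem finite_setOf_eq_of_summable_sq (ha : Summable fun i => a i ^ 2) {c : ℝ} (hc : c ≠ 0) :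
    {i | a i = c}.Finite := by
  have h := ha.tendsto_cofinite_zero.eventually (gt_mem_nhds (by positivity : 0 < c ^ 2))
  refine (eventually_cofinite.1 h).subset fun i hi => ?_
  rw [mem_ofPred_eq] at hi ⊢
  rw [hi]
  exact lt_irrefl _

/-- A square summable family with values in `{0, 1, c}` takes the nonzero values finitely often. -/
theorem exists_multiplicities (ha : Summable fun i => a i ^ 2) {c : ℝ} (hc : 0 ≤ c)
    (h : ∀ i, a i = 0 ∨ a i = 1 ∨ a i = c) :
    -- An arbitrary `φ` with `φ 0 = 0` lets the same multiplicities serve both for the sum of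
    -- squares and for the characteristic exponent.
    ∃ ℓ₁ ℓ₂ : ℕ, (ℓ₁ = 0 ∨ 0 < c) ∧ ∀ φ : ℝ → ℂ, φ 0 = 0 →
      HasSum (fun i => φ (a i)) (ℓ₁ * φ c + ℓ₂ * φ 1) := by
  classical
  set s : Finset ι := (finite_setOf_eq_of_summable_sq ha one_ne_zero).toFinset
  have hs : ∀ i, i ∈ s ↔ a i = 1 := fun i => by simp [s]
  -- If `c` coincides with 0 or 1, taking `ℓ₁ = 0` avoids counting an eigenvalue twice.
  by_cases hc' : c = 0 ∨ c = 1
  · refine ⟨0, s.card, Or.inl rfl, fun φ hφ => ?_⟩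
    have h1 : HasSum (fun i => φ (a i)) (∑ i ∈ s, φ (a i)) :=
      hasSum_sum_of_ne_finset_zero fun i hi => by
        rw [hs] at hi
        have : a i = 0 := by
          rcases hc' with hc' | hc' <;> rcases h i with h | h | h <;> simp_all
        rw [this, hφ]
    rw [Finset.sum_congr rfl fun i hi => by rw [(hs i).1 hi], Finset.sum_const,
      nsmul_eq_mul] at h1
    simpa using h1
  · rw [not_or] at hc'
    set s' : Finset ι := (finite_setOf_eq_of_summable_sq ha hc'.1).toFinset
    have hs' : ∀ i, i ∈ s' ↔ a i = c := fun i => by simp [s']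
    have hdisj : Disjoint s' s := by
      rw [Finset.disjoint_left]
      intro i hi hi'
      rw [hs'] at hi
      rw [hs] at hi'
      exact hc'.2 (hi.symm.trans hi')
    refine ⟨s'.card, s.card, Or.inr (lt_of_le_of_ne hc (Ne.symm hc'.1)), fun φ hφ => ?_⟩
    have h1 : HasSum (fun i => φ (a i)) (∑ i ∈ s' ∪ s, φ (a i)) :=
      hasSum_sum_of_ne_finset_zero fun i hi => by
        rw [Finset.mem_union, hs, hs', not_or] at hi
        rw [((h i).resolve_right fun h => h.elim hi.2 hi.1), hφ]
    rw [Finset.sum_union hdisj, Finset.sum_congr rfl fun i hi => by rw [(hs' i).1 hi],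
      Finset.sum_congr (s₁ := s) rfl fun i hi => by rw [(hs i).1 hi], Finset.sum_const,
      Finset.sum_const, nsmul_eq_mul, nsmul_eq_mul] at h1
    exact h1

end Spectrum

/-! ### Identification of the law from the spectrum, and the main theorem. -/

theorem isProbabilityMeasure_scaledGammaLaw {ℓ : ℕ} {k : ℝ} (hk : ℓ = 0 ∨ 0 < k) :
    IsProbabilityMeasure (scaledGammaLaw ℓ k) := by
  rw [scaledGammaLaw]
  split_ifs with h
  · infer_instance
  have hk := hk.resolve_left h
  have hl : (0 : ℝ) < ℓ := by exact_mod_cast Nat.pos_of_ne_zero h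
  have : IsProbabilityMeasure (gammaMeasure ((ℓ : ℝ) / 2) (2 / k)) :=
    isProbabilityMeasure_gammaMeasure (by positivity) (by positivity)
  exact Measure.isProbabilityMeasure_map (by fun_prop)

theorem isProbabilityMeasure_centeredGammaLaw {ν : ℝ} (hν : 0 < ν) :
    IsProbabilityMeasure (centeredGammaLaw ν) := by
  have := isProbabilityMeasure_gammaMeasure (half_pos hν) one_pos
  exact Measure.isProbabilityMeasure_map (by fun_prop)

@[simp]
theorem centeredChiSqCgf_zero : centeredChiSqCgf 0 = 0 := by simp [centeredChiSqCgf]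

namespace IsIsonormal

variable {Ω : Type*} {mΩ : MeasurableSpace Ω} {P : Measure Ω} [IsProbabilityMeasure P]
  {H : Type*} [NormedAddCommGroup H] [InnerProductSpace ℝ H] {X : H → Ω → ℝ}
  {ι : Type*} {e : ι → H} {a : ι → ℝ} {F : Lp ℝ 2 P} {ν : ℝ}

theorem map_eq_centeredGammaLaw (hX : IsIsonormal X P) (he : Orthonormal ℝ e)
    (hF : HasSum (fun i => a i • hX.chaosVar (e i)) F) (hν : 0 < ν)
    (ha : HasSum (fun i => a i ^ 2) ν) (h : ∀ i, a i = 0 ∨ a i = 1) :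
    P.map F = centeredGammaLaw ν := by
  have := isProbabilityMeasure_centeredGammaLaw hν
  have hm : IsProbabilityMeasure (P.map F) :=
    Measure.isProbabilityMeasure_map (Lp.memLp F).1.aemeasurable
  refine Measure.ext_of_charFun (funext fun t => ?_)
  rw [charFun_centeredGammaLaw hν]
  refine hX.charFun_map_eq_exp he hF
    (((Complex.hasSum_ofReal.2 ha).mul_right _).congr_fun fun i => ?_)
  rcases h i with h | h <;> simp [h]

theorem exists_map_eq_conv (hX : IsIsonormal X P) (he : Orthonormal ℝ e)
    (hF : HasSum (fun i => a i • hX.chaosVar (e i)) F)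
    (ha : HasSum (fun i => a i ^ 2) ν) {k : ℝ} (hk : 0 ≤ k)
    (h : ∀ i, a i = 0 ∨ a i = 1 ∨ a i = k / 2) :
    ∃ ℓ₁ ℓ₂ : ℕ, (ℓ₁ : ℝ) * (k ^ 2 / 4) + ℓ₂ = ν ∧
      P.map F = Measure.conv (scaledGammaLaw ℓ₁ k) (scaledGammaLaw ℓ₂ 2) ∧
      P.map F = mixedChiSqLaw ℓ₁ ℓ₂ k := by
  obtain ⟨ℓ₁, ℓ₂, hl, hφ⟩ := exists_multiplicities ha.summable (by positivity) h
  have hl' : ℓ₁ = 0 ∨ 0 < k := hl.imp_right fun h => by linarith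
  have := isProbabilityMeasure_scaledGammaLaw hl'
  have := isProbabilityMeasure_scaledGammaLaw (ℓ := ℓ₂) (Or.inr two_pos)
  have hm : IsProbabilityMeasure (P.map F) :=
    Measure.isProbabilityMeasure_map (Lp.memLp F).1.aemeasurable
  have hm' : IsProbabilityMeasure (mixedChiSqLaw ℓ₁ ℓ₂ k) :=
    Measure.isProbabilityMeasure_map (by fun_prop)
  have hchar : ∀ t, charFun (P.map F) t =
      centeredChiSqTransform (Complex.I * t * (k / 2 : ℝ)) ^ ℓ₁ *
        centeredChiSqTransform (Complex.I * t) ^ ℓ₂ := by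
    intro t
    rw [hX.charFun_map_eq_exp he hF
      (hφ (fun x => centeredChiSqCgf (Complex.I * t * x)) (by simp)), Complex.exp_add,
      Complex.exp_nat_mul, Complex.exp_nat_mul, Complex.ofReal_one, mul_one]
    rfl
  refine ⟨ℓ₁, ℓ₂, ?_, Measure.ext_of_charFun (funext fun t => ?_),
    Measure.ext_of_charFun (funext fun t => ?_)⟩
  · have h1 := hφ (fun x => (x : ℂ) ^ 2) (by simp)
    have h2 := (Complex.hasSum_ofReal.2 ha).unique (by simpa using h1)
    have h3 : (ν : ℂ) = ((ℓ₁ * (k ^ 2 / 4) + ℓ₂ : ℝ) : ℂ) := by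
      rw [h2]
      push_cast
      ring
    exact (Complex.ofReal_injective h3).symm
  · rw [hchar, charFun_conv, charFun_scaledGammaLaw hl', charFun_scaledGammaLaw (Or.inr two_pos)]
    simp
  · rw [hchar, charFun_mixedChiSqLaw]

end IsIsonormal

theorem IsIsonormal.hasSum_sq_coeff {Ω : Type*} {mΩ : MeasurableSpace Ω} {P : Measure Ω}
    [IsProbabilityMeasure P] {H : Type*} [NormedAddCommGroup H] [InnerProductSpace ℝ H]
    [CompleteSpace H] [TopologicalSpace.SeparableSpace H] {X : H → Ω → ℝ} {ι : Type*} {e : ι → H}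
    {a : ι → ℝ} {F : Lp ℝ 2 P} (hX : IsIsonormal X P) (he : Orthonormal ℝ e)
    (ha : Summable fun i => a i ^ 2) (hF : F ∈ wienerChaos X P 2)
    (hFsum : HasSum (fun i => a i • hX.chaosVar (e i)) F) {ν : ℝ}
    (hF2 : ∫ ω, (F ω) ^ 2 ∂P = 2 * ν) : HasSum (fun i => a i ^ 2) ν := by
  have h := (hX.isDiagonal_gammaOp he ha hF hFsum 0).hasSum_variance he
  have hv : variance (gammaOp X P F 0) P = 2 * ν := by
    have hm : MemLp (fun ω => F ω) 2 P := Lp.memLp F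
    rw [← hF2, gammaOp, variance_eq_sub hm, hX.integral_eq_zero_of_mem_wienerChaos hF]
    simp
  rw [hv] at h
  simpa using h.mul_left (2⁻¹ : ℝ)

theorem mainTheorem12 {Ω : Type*} {mΩ : MeasurableSpace Ω} (P : Measure Ω) [IsProbabilityMeasure P]
    {H : Type*} [NormedAddCommGroup H] [InnerProductSpace ℝ H] [CompleteSpace H]
    [TopologicalSpace.SeparableSpace H]
    (X : H → Ω → ℝ) (hX : IsIsonormal X P)
    (ν : ℝ) (hν : 0 < ν)
    (F : Lp ℝ 2 P) (hF : F ∈ wienerChaos X P 2) (hF2 : ∫ ω, (F ω) ^ 2 ∂P = 2 * ν)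
    (hcov : 0 ≤ covariance (gammaDiff X P F 2) (gammaDiff X P F 1) P) :
    -- local maximum at `0`
    ((0 < covariance (gammaDiff X P F 2) (gammaDiff X P F 1) P ∨
        variance (gammaDiff X P F 1) P = 0) → IsLocalMax (biquadraticPhi X P F) 0) ∧
    -- global minimum at `±β_min`, and nowhere else unless `Var(Γ₂ - 2Γ₁) = 0`
    (∀ β : ℝ, biquadraticPhi X P F (betaMin X P F) ≤ biquadraticPhi X P F β ∧
      biquadraticPhi X P F (-betaMin X P F) ≤ biquadraticPhi X P F β) ∧
    (variance (gammaDiff X P F 1) P ≠ 0 → ∀ β : ℝ,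
      (∀ β' : ℝ, biquadraticPhi X P F β ≤ biquadraticPhi X P F β') →
        β = betaMin X P F ∨ β = -betaMin X P F) ∧
    -- characterization of `G(ν)`
    (P.map F = centeredGammaLaw ν ↔
      ∃ β : ℝ, β ≠ betaMin X P F ∧ β ≠ -betaMin X P F ∧ biquadraticPhi X P F β = 0) ∧
    (biquadraticPhi X P F 1 = 0 → P.map F = centeredGammaLaw ν) ∧
    -- the value at `β = 1`
    0 ≤ biquadraticPhi X P F 1 ∧
    biquadraticPhi X P F 1 =
      cumulant P F 8 / Nat.factorial 7 - 8 * (cumulant P F 7 / Nat.factorial 6)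
        + 24 * (cumulant P F 6 / Nat.factorial 5) - 32 * (cumulant P F 5 / Nat.factorial 4)
        + 16 * (cumulant P F 4 / Nat.factorial 3) ∧
    biquadraticPhi X P F 1 ≤ 2 * (variance (gammaDiff X P F 0) P) ^ 2 ∧
    -- case (I)
    (betaZero X P F ≤ 1 →
      variance (gammaDiff X P F 2) P ≤ 2 * (variance (gammaDiff X P F 0) P) ^ 2) ∧
    -- case (II)
    (1 ≤ betaZero X P F →
      biquadraticPhi X P F (-betaMin X P F) = biquadraticPhi X P F (betaMin X P F) ∧
      biquadraticPhi X P F (betaMin X P F) = variance (gammaDiff X P F 2) P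
        - (mixedMoment X P F) ^ 2 / variance (gammaDiff X P F 1) P ∧
      variance (gammaDiff X P F 2) P
          - (mixedMoment X P F) ^ 2 / variance (gammaDiff X P F 1) P
        ≤ variance (fun ω => gammaDiff X P F 2 ω - 2 * gammaDiff X P F 1 ω) P ∧
      variance (fun ω => gammaDiff X P F 2 ω - 2 * gammaDiff X P F 1 ω) P
        ≤ variance (gammaDiff X P F 2) P) ∧
    -- vanishing at the minimizers
    ((biquadraticPhi X P F (betaMin X P F) = 0 ∨ biquadraticPhi X P F (-betaMin X P F) = 0) →
      ∃ ℓ₁ ℓ₂ : ℕ, (ℓ₁ : ℝ) * ((betaZero X P F ^ 2) ^ 2 / 4) + ℓ₂ = ν ∧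
        P.map F = Measure.conv (scaledGammaLaw ℓ₁ (betaZero X P F ^ 2)) (scaledGammaLaw ℓ₂ 2) ∧
        P.map F = mixedChiSqLaw ℓ₁ ℓ₂ (betaZero X P F ^ 2)) := by
  obtain ⟨ι, e, a, he, ha, hFsum⟩ := hX.exists_hasSum_chaosVar hF
  have hν2 : HasSum (fun i => a i ^ 2) ν := hX.hasSum_sq_coeff he ha hF hFsum hF2
  have hd := hX.isDiagonal_gammaDiff he ha hF hFsum
  have hΦ1 : variance (fun ω => gammaDiff X P F 2 ω - 2 * gammaDiff X P F 1 ω) P =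
      biquadraticPhi X P F 1 := by
    simp [biquadraticPhi]
  have hΦs : ∀ β, HasSum (fun i => 2 * (8 * a i ^ 2 * (a i - 1) * (a i - β ^ 2)) ^ 2)
      (biquadraticPhi X P F β) := fun β =>
    (hX.isDiagonal_biquadratic he ha hF hFsum β).hasSum_variance he
  have hMs := (hd 2).hasSum_covariance he (hd 1)
  have hVs := (hd 1).hasSum_variance he
  have hWs := (hd 2).hasSum_variance he
  have hV0s := (hd 0).hasSum_variance he
  rw [hΦ1]
  rw [betaMin, betaZero, hX.mixedMoment_eq_covariance he ha hF hFsum]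
  generalize covariance (gammaDiff X P F 2) (gammaDiff X P F 1) P = M at *
  generalize variance (gammaDiff X P F 1) P = V at *
  generalize variance (gammaDiff X P F 2) P = W at *
  generalize variance (gammaDiff X P F 0) P = V₀ at *
  have hφ : ∀ β, biquadraticPhi X P F β = W - 4 * β ^ 2 * M + 4 * β ^ 4 * V := by
    intro β
    refine (hΦs β).unique ?_
    refine ((hWs.sub (hMs.mul_left (4 * β ^ 2))).add (hVs.mul_left (4 * β ^ 4))).congr_fun
      fun i => ?_
    ring
  -- A vanishing sum of squares kills each coefficient `8λᵢ² (λᵢ - 1) (λᵢ - β²)`.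
  have hroots : ∀ β, biquadraticPhi X P F β = 0 → ∀ i, a i = 0 ∨ a i = 1 ∨ a i = β ^ 2 := by
    intro β hβ i
    have h := hΦs β
    rw [hβ] at h
    have := eq_zero_of_hasSum_sq two_pos h i
    simpa [sub_eq_zero, or_assoc] using this
  have hnonneg : ∀ β, 0 ≤ biquadraticPhi X P F β := fun β => variance_nonneg _ _
  have hV : 0 ≤ V := hVs.nonneg fun i => by positivity
  have hrootsV : V = 0 → ∀ i, a i = 0 ∨ a i = 1 := by
    intro hV0 i
    rw [hV0] at hVs
    have := eq_zero_of_hasSum_sq two_pos hVs i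
    simpa [sub_eq_zero] using this
  have hVM : V = 0 → M = 0 := by
    intro hV0
    refine hMs.unique (hasSum_zero.congr_fun fun i => ?_)
    rcases hrootsV hV0 i with h | h <;> simp [h]
  have hVroots : (∀ i, a i = 0 ∨ a i = 1) → V = 0 := by
    intro h
    refine hVs.unique (hasSum_zero.congr_fun fun i => ?_)
    rcases h i with h | h <;> simp [h]
  have hquad := biquadratic_eq hφ hcov hV hVM
  have hneg := biquadratic_neg hφ
  have hmin : ∀ β, biquadraticPhi X P F √(M / (2 * V)) ≤ biquadraticPhi X P F β := by
    intro β
    rw [hquad β]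
    exact le_add_of_nonneg_right (by positivity)
  have hmin_sq : √(M / (2 * V)) ^ 2 = M / (2 * V) := Real.sq_sqrt (by positivity)
  have hzero_sq : √(M / V) ^ 2 = M / V := Real.sq_sqrt (by positivity)
  have huniq : V ≠ 0 → ∀ β, (∀ β', biquadraticPhi X P F β ≤ biquadraticPhi X P F β') →
      β = √(M / (2 * V)) ∨ β = -√(M / (2 * V)) := by
    intro hV0 β hβ
    have h1 := hβ √(M / (2 * V))
    rw [hquad β] at h1
    have h2 : 0 < 4 * V := by positivity
    have h3 : (β ^ 2 - M / (2 * V)) ^ 2 = 0 :=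
      le_antisymm (nonpos_of_mul_nonpos_right (by linarith) h2) (sq_nonneg _)
    rw [← sq_eq_sq_iff_eq_or_eq_neg, hmin_sq]
    exact sub_eq_zero.1 (by simpa using h3)
  have hlaw : (∀ i, a i = 0 ∨ a i = 1) → P.map F = centeredGammaLaw ν :=
    hX.map_eq_centeredGammaLaw he hFsum hν hν2
  have hlaw1 : biquadraticPhi X P F 1 = 0 → P.map F = centeredGammaLaw ν := fun h =>
    hlaw fun i => by simpa using hroots 1 h i
  have hcum : biquadraticPhi X P F 1 =
      cumulant P F 8 / Nat.factorial 7 - 8 * (cumulant P F 7 / Nat.factorial 6)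
        + 24 * (cumulant P F 6 / Nat.factorial 5) - 32 * (cumulant P F 5 / Nat.factorial 4)
        + 16 * (cumulant P F 4 / Nat.factorial 3) := by
    have hp : ∀ n, 2 ≤ n → HasSum (fun i => a i ^ n) (∑' i, a i ^ n) := fun n hn =>
      (summable_pow_of_summable_sq ha hn).hasSum
    have hc : ∀ n, 2 ≤ n → HasSum (fun i => 2 ^ (n - 1) * a i ^ n)
        (cumulant P F n / Nat.factorial (n - 1)) := by
      intro n hn
      rw [hX.cumulant_eq he ha hFsum hn, mul_right_comm, mul_div_assoc, div_self (by positivity),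
        mul_one]
      exact (hp n hn).mul_left _
    refine (hΦs 1).unique (((((hc 8 (by norm_num)).sub ((hc 7 (by norm_num)).mul_left 8)).add
      ((hc 6 (by norm_num)).mul_left 24)).sub ((hc 5 (by norm_num)).mul_left 32)).add
      ((hc 4 (by norm_num)).mul_left 16) |>.congr_fun fun i => ?_)
    norm_num
    ring
  have hbound : biquadraticPhi X P F 1 ≤ 2 * V₀ ^ 2 := by
    -- `V₀ = 8 ∑ bᵢ` and `Φ_F(1) = 128 ∑ bᵢ²` with `bᵢ = λᵢ² (λᵢ - 1)²`, and `128 / 8² = 2`.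
    have h1 : HasSum (fun i => a i ^ 2 * (a i - 1) ^ 2) (V₀ / 8) :=
      (hV0s.div_const 8).congr_fun fun i => by ring
    have h2 : HasSum (fun i => (a i ^ 2 * (a i - 1) ^ 2) ^ 2) (biquadraticPhi X P F 1 / 128) :=
      ((hΦs 1).div_const 128).congr_fun fun i => by ring
    have := hasSum_sq_le_sq (fun i => by positivity) h1 h2
    linarith
  refine ⟨biquadratic_isLocalMax_zero hφ hcov, fun β => ⟨hmin β, by rw [hneg]; exact hmin β⟩,
    huniq, ⟨fun h => ?_, ?_⟩, hlaw1, hnonneg 1, hcum, hbound, fun h => ?_, fun h => ?_,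
    fun h => ?_⟩
  -- The law determines the cumulants; for `G(ν)` the combination is `128 ν (1 - 4 + 6 - 4 + 1) =
  -- 0`. Hence `V = 0` and `β_min = 0`, so `β = 1` is an admissible witness.
  · have h1 : biquadraticPhi X P F 1 = 0 := by
      rw [hcum]
      simp only [cumulant_of_map_eq_centeredGammaLaw hν h (by norm_num : 2 ≤ 8),
        cumulant_of_map_eq_centeredGammaLaw hν h (by norm_num : 2 ≤ 7),
        cumulant_of_map_eq_centeredGammaLaw hν h (by norm_num : 2 ≤ 6),
        cumulant_of_map_eq_centeredGammaLaw hν h (by norm_num : 2 ≤ 5),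
        cumulant_of_map_eq_centeredGammaLaw hν h (by norm_num : 2 ≤ 4)]
      norm_num [Nat.factorial]
      ring
    have hV0 := hVroots fun i => by simpa using hroots 1 h1 i
    exact ⟨1, by simp [hV0], by simp [hV0], h1⟩
  · rintro ⟨β, hβ1, hβ2, hβ⟩
    refine hlaw (hrootsV ?_)
    -- As `Φ_F ≥ 0`, a zero is a global minimizer, so `V ≠ 0` would place it at `±β_min`.
    by_contra hV0
    exact (huniq hV0 β fun β' => by rw [hβ]; exact hnonneg β').elim hβ1 hβ2
  · refine le_trans ?_ hbound
    have h1 : M ≤ V := by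
      rcases eq_or_ne V 0 with hV0 | hV0
      · rw [hV0, hVM hV0]
      · have h2 : √(M / V) ^ 2 ≤ 1 := pow_le_one₀ (Real.sqrt_nonneg _) h
        rwa [hzero_sq, div_le_one (by positivity)] at h2
    -- Here `W = Φ_F(1) + 4(M - V)`, and `M ≤ V`.
    rw [hφ]
    linarith
  -- For `V = 0` the convention makes `β₀ = 0`, contradicting `1 ≤ β₀`.
  · have hV0 : V ≠ 0 := by
      rintro rfl
      norm_num at h
    have hV' : 0 < V := by positivity
    have h1 : V ≤ M := by
      have h2 : 1 ≤ √(M / V) ^ 2 := one_le_pow₀ h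
      rwa [hzero_sq, one_le_div hV'] at h2
    have hval : biquadraticPhi X P F √(M / (2 * V)) = W - M ^ 2 / V := by
      have h4 : √(M / (2 * V)) ^ 4 = (M / (2 * V)) ^ 2 := by
        rw [show √(M / (2 * V)) ^ 4 = (√(M / (2 * V)) ^ 2) ^ 2 by ring, hmin_sq]
      rw [hφ, hmin_sq, h4]
      field_simp
      ring
    refine ⟨hneg _, hval, hval ▸ hmin 1, ?_⟩
    rw [hφ]
    linarith
  · have h0 : biquadraticPhi X P F √(M / (2 * V)) = 0 := by
      rcases h with h | h
      · exact h
      · rwa [hneg] at h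
    -- The third possible eigenvalue `β_min²` is `k / 2` with `k = β₀²`.
    have hk : √(M / V) ^ 2 / 2 = √(M / (2 * V)) ^ 2 := by
      rw [hmin_sq, hzero_sq, div_div, mul_comm V]
    refine hX.exists_map_eq_conv he hFsum hν2 (sq_nonneg _) fun i => ?_
    rw [hk]
    exact hroots _ h0 i
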